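/- Let $\mathbb F_q$ be a finite field, let $m\ge 2$ be an integer not divisible by $\operatorname{char}\mathbb F_q$, and let $f(x)\in\mathbb F_q[x]$ be a polynomial of degree at least $2$, all of whose roots lie in $\mathbb F_q$, that is not a $d$-th power of an element of $\mathbb F_q(x)$ for any divisor $d\ge 2$ of $m$. Let $F=\mathbb F_q(x)(y)$ with $y^m=f(x)$. Let $P_1,\dots,P_r$ be the pairwise distinct places of $\mathbb F_q(x)$ that are zeros or poles of $f(x)$ (so the pole of $x$ is among them), and put $\lambda_k=\nu_{P_k}(f(x))\in\mathbb Z$, where $\nu_{P_k}$ is the normalized discrete valuation at $P_k$. Let $2\le n\le q$ and $n\le r$, suppose that $P_1,\dots,P_n$ are totally ramified in $F/\mathbb F_q(x)$, and let $Q_k$ be the place of $F$ above $P_k$ for $1\le k\le n$. For $1\le i\le m-1$ define $$t_k(i)=(i\lambda_k)\bmod m\in\{0,\dots,m-1\}\quad(1\le k\le n),\qquad \beta(i)=\Bigl(\sum_{k=1}^{r}\Bigl\lceil\frac{i\lambda_k}{m}\Bigr\rceil\Bigr)-1 .$$ Then for every $\alpha=(\alpha_1,\dots,\alpha_n)\in\mathbb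 Z^n$ the Riemann–Roch space $\mathcal L(D)=\{z\in F^{*}:(z)+D\ge 0\}\cup\{0\}$ of the divisor $D=\sum_{k=1}^{n}\alpha_kQ_k$ has finite dimension over $\mathbb F_q$, equal to $$\ell(D)=\max\Bigl\{0,\,1+\sum_{k=1}^{n}\Bigl\lfloor\frac{\alpha_k}{m}\Bigr\rfloor\Bigr\}+\sum_{i=1}^{m-1}\max\Bigl\{0,\,n-\beta(i)+\sum_{k=1}^{n}\Bigl\lfloor\frac{\alpha_k-t_k(i)}{m}\Bigr\rfloor\Bigr\}.$$ -/

import Mathlib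

/-! Places, divisors, Riemann–Roch spaces and ramification for an extension of function fields
over a constant field `K`. -/

open scoped WithZero

namespace AlgFun

/-- A place of `F / K`, given by its normalized discrete valuation (written multiplicatively):
a surjective valuation `F → ℤᵐ⁰` that is trivial on the constants. Since the valuation is
normalized, two places are equal exactly when their valuation rings are. When `F` is a function
field in one variable over `K`, these are all the places, because each valuation ring
`K ⊆ O ⊊ F` of `F` is a discrete valuation ring. -/
@[ext]
structure Place (K F : Type*) [Field K] [Field F] [Algebra K F] where
  /-- The normalized valuation; its value at `z ≠ 0` is `exp (-ν z)`. -/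
  val : Valuation F ℤᵐ⁰
  surjective : Function.Surjective val
  val_const : ∀ a : K, a ≠ 0 → val (algebraMap K F a) = 1

section

variable {K F : Type*} [Field K] [Field F] [Algebra K F]

/-- The order `ν_P(z) ∈ ℤ` of a nonzero `z` at the place `P` (with the junk value `0` at `z = 0`). -/
noncomputable def Place.ord (P : Place K F) (z : F) : ℤ := -WithZero.log (P.val z)

/-- Divisors of `F / K`: the free abelian group on the places. -/
abbrev Divisor (K F : Type*) [Field K] [Field F] [Algebra K F] : Type _ := Place K F →₀ ℤ

theorem Place.ord_mul (P : Place K F) {x y : F} (hx : x ≠ 0) (hy : y ≠ 0) :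
    P.ord (x * y) = P.ord x + P.ord y := by
  have h1 : P.val x ≠ 0 := by simpa using hx
  have h2 : P.val y ≠ 0 := by simpa using hy
  unfold Place.ord
  rw [map_mul, WithZero.log_mul h1 h2]
  ring

theorem Place.le_ord_add (P : Place K F) {x y : F} {c : ℤ} (hx : x ≠ 0) (hy : y ≠ 0)
    (hxy : x + y ≠ 0) (h1 : c ≤ P.ord x) (h2 : c ≤ P.ord y) : c ≤ P.ord (x + y) := by
  have n1 : P.val x ≠ 0 := by simpa using hx
  have n2 : P.val y ≠ 0 := by simpa using hy
  have n3 : P.val (x + y) ≠ 0 := (Valuation.ne_zero_iff _).2 hxy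
  unfold Place.ord at *
  rcases le_max_iff.1 (P.val.map_add x y) with h | h
  · have := (WithZero.log_le_log n3 n1).2 h
    omega
  · have := (WithZero.log_le_log n3 n2).2 h
    omega

theorem Place.ord_const (P : Place K F) {a : K} (ha : a ≠ 0) :
    P.ord (algebraMap K F a) = 0 := by
  simp [Place.ord, P.val_const a ha]

/-- The Riemann–Roch space `ℒ(D) = {z ≠ 0 : (z) + D ≥ 0} ∪ {0}`. -/
def riemannRochSpace (D : Divisor K F) : Submodule K F where
  carrier := {z | z ≠ 0 → ∀ P : Place K F, 0 ≤ P.ord z + D P}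
  zero_mem' := fun h => absurd rfl h
  add_mem' := by
    intro x y hx hy hxy P
    by_cases x0 : x = 0
    · subst x0
      rw [zero_add] at hxy ⊢
      exact hy hxy P
    by_cases y0 : y = 0
    · subst y0
      rw [add_zero] at hxy ⊢
      exact hx hxy P
    have h1 := hx x0 P
    have h2 := hy y0 P
    have := P.le_ord_add (c := -D P) x0 y0 hxy (by omega) (by omega)
    omega
  smul_mem' := by
    intro a x hx hax P
    have a0 : a ≠ 0 := by
      rintro rfl
      simp at hax
    have x0 : x ≠ 0 := by
      rintro rfl
      simp at hax
    have h0 : algebraMap K F a ≠ 0 := by simpa using a0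
    rw [Algebra.smul_def, P.ord_mul h0 x0, P.ord_const a0, zero_add]
    exact hx x0 P

/-- `ℓ(D) = dim_K ℒ(D)`. -/
noncomputable def ell (D : Divisor K F) : ℕ := Module.finrank K (riemannRochSpace D)

end

section

variable {K E F : Type*} [Field K] [Field E] [Field F] [Algebra K E] [Algebra K F] [Algebra E F]

/-- The place `Q` of `F` lies over the place `P` of `E` with ramification index `e(Q|P) = e`:
`ν_Q(z) = e · ν_P(z)` for all `z ∈ E`, where `e ≥ 1`. -/
def HasRamificationIndex (Q : Place K F) (P : Place K E) (e : ℕ) : Prop :=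
  0 < e ∧ ∀ z : E, Q.ord (algebraMap E F z) = e * P.ord z

/-- `Q` lies over `P` and is totally ramified: `e(Q|P) = [F : E]`. -/
def IsTotallyRamified (Q : Place K F) (P : Place K E) : Prop :=
  HasRamificationIndex Q P (Module.finrank E F)

end

/-- `t(i) = (i λ) mod m`, the least non-negative residue. -/
def kummerT (m : ℕ) (lam : ℤ) (i : ℕ) : ℤ := (i * lam) % m

/-- `β(i) = ∑_{k=1}^r ⌈i λ_k / m⌉ - 1`, the `1` being subtracted once, from the whole sum. -/
def kummerBeta (m : ℕ) {r : ℕ} (lam : Fin r → ℤ) (i : ℕ) : ℤ :=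
  (∑ k : Fin r, ⌈((i : ℚ) * (lam k : ℚ)) / (m : ℚ)⌉) - 1

end AlgFun

/-! Write `z ∈ F` as `∑ aᵢ y⁻ⁱ` with `0 ≤ i < m` and `aᵢ ∈ K(x)`. The condition `z ∈ ℒ(D)` splits
into one condition on each `aᵢ`, so `ℒ(D)` is a direct sum of Riemann–Roch spaces of `K(x)`, which
has genus zero.

Total ramification forces `gcd(λ_k, m) = 1` (`gcd_ord_eq_one`): otherwise a tame root of a local
unit would lie in `K(x)`, and `f` would be a proper power. Hence `[F : K(x)] = m`, and at `Q_k` the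
orders `m ν(aᵢ) - i λ_k` of the nonzero terms differ modulo `m`. The order of the sum is then the
least of them, which splits the condition at `Q_k`.

At the remaining places, regularity above a place `R` of `K(x)` is integrality over `O_R`. Averaging
over the conjugates `y ↦ ζ^j y` in an algebraic closure passes integrality to each term, since `m`
is a unit (`isIntegral_kummer_term`). No knowledge of the ramification above `R` is needed.

Thus `aᵢ` ranges over `ℒ(∑ ⌊(α_k - i λ_k)/m⌋ P_k)`, with `α_k = 0` for `k > n`. As `f` splits, every
`P_k` is rational, so the dimension is `max(0, 1 + degree)`. `kummer_floor_identity` rewrites the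
degree through `β` and `t`. -/

namespace AlgFun

/-! ### Orders at a place, and normalization of valuations -/

section PlaceLemmas

variable {K F : Type*} [Field K] [Field F] [Algebra K F]

@[simp] theorem Place.ord_zero (P : Place K F) : P.ord 0 = 0 := by simp [Place.ord]

@[simp] theorem Place.ord_one (P : Place K F) : P.ord 1 = 0 := by simp [Place.ord]

theorem Place.val_eq_exp (P : Place K F) {z : F} (hz : z ≠ 0) :
    P.val z = WithZero.exp (-P.ord z) := by
  have h1 : P.val z ≠ 0 := by simpa using hz
  rw [Place.ord, neg_neg, WithZero.exp_log h1]

theorem Place.val_le_one_iff (P : Place K F) {z : F} (hz : z ≠ 0) :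
    P.val z ≤ 1 ↔ 0 ≤ P.ord z := by
  rw [P.val_eq_exp hz, ← WithZero.exp_zero, WithZero.exp_le_exp]
  omega

theorem Place.ord_inv (P : Place K F) (z : F) : P.ord z⁻¹ = -P.ord z := by
  simp [Place.ord, WithZero.log_inv]

theorem Place.ord_pow (P : Place K F) (z : F) (n : ℕ) : P.ord (z ^ n) = n * P.ord z := by
  simp [Place.ord, WithZero.log_pow]

theorem Place.ord_zpow (P : Place K F) (z : F) (n : ℤ) : P.ord (z ^ n) = n * P.ord z := by
  simp [Place.ord, WithZero.log_zpow]

theorem Place.ord_neg (P : Place K F) (z : F) : P.ord (-z) = P.ord z := by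
  simp [Place.ord, Valuation.map_neg]

theorem Place.ord_prod (P : Place K F) {ι : Type*} (s : Finset ι) (u : ι → F)
    (hu : ∀ i ∈ s, u i ≠ 0) : P.ord (∏ i ∈ s, u i) = ∑ i ∈ s, P.ord (u i) := by
  classical
  induction s using Finset.induction_on with
  | empty => simp
  | insert a s ha ih =>
    rw [Finset.prod_insert ha, Finset.sum_insert ha, P.ord_mul (hu a (by simp))
      (Finset.prod_ne_zero_iff.2 fun i hi => hu i (by simp [hi])),
      ih fun i hi => hu i (by simp [hi])]

theorem Place.ext_ord {P Q : Place K F} (h : ∀ z ≠ 0, P.ord z = Q.ord z) : P = Q := by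
  ext z
  by_cases hz : z = 0
  · simp [hz]
  · rw [P.val_eq_exp hz, Q.val_eq_exp hz, h z hz]

theorem Place.exists_ord_eq (P : Place K F) (n : ℤ) : ∃ z : F, z ≠ 0 ∧ P.ord z = n := by
  obtain ⟨z, hz⟩ := P.surjective (WithZero.exp (-n))
  refine ⟨z, ?_, ?_⟩
  · rintro rfl
    simp at hz
    exact WithZero.exp_ne_zero hz.symm
  · simp [Place.ord, hz]

/-- If `O_R ⊆ O_P` then `P = R`. -/
theorem Place.eq_of_forall_ord_nonneg {P R : Place K F}
    (h : ∀ z ≠ 0, 0 ≤ R.ord z → 0 ≤ P.ord z) : P = R := by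
  have hunit : ∀ z ≠ 0, R.ord z = 0 → P.ord z = 0 := by
    intro z hz h0
    have h1 := h z hz h0.ge
    have h2 := h z⁻¹ (inv_ne_zero hz) (by rw [R.ord_inv, h0]; rfl)
    rw [P.ord_inv] at h2
    omega
  -- Units of `O_R` are units of `O_P`, so `ν_P` is `ν_P(t)` times `ν_R`; surjectivity of `ν_P`
  -- forces `ν_P(t) = 1`.
  obtain ⟨t, ht, ht1⟩ := R.exists_ord_eq 1
  have key : ∀ z ≠ 0, P.ord z = R.ord z * P.ord t := by
    intro z hz
    have h0 : z * (t ^ R.ord z)⁻¹ ≠ 0 := mul_ne_zero hz (inv_ne_zero (zpow_ne_zero _ ht))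
    have := hunit _ h0 (by
      rw [R.ord_mul hz (inv_ne_zero (zpow_ne_zero _ ht)), R.ord_inv, R.ord_zpow, ht1]; ring)
    rw [P.ord_mul hz (inv_ne_zero (zpow_ne_zero _ ht)), P.ord_inv, P.ord_zpow] at this
    linarith
  obtain ⟨s, hs, hs1⟩ := P.exists_ord_eq 1
  have h1 : P.ord t ∣ 1 := ⟨R.ord s, by rw [← hs1, key s hs]; ring⟩
  have h2 : P.ord t = 1 := by
    have := h t ht (by omega)
    exact Int.eq_one_of_dvd_one this h1
  exact Place.ext_ord fun z hz => by rw [key z hz, h2, mul_one]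

/-- If the nonzero terms of a sum have pairwise distinct orders, the order of the sum is the
least of them. -/
theorem Place.exists_ord_sum_eq (P : Place K F) {ι : Type*} [Fintype ι] (u : ι → F)
    (hne : ∃ i, u i ≠ 0)
    (hinj : ∀ i j, u i ≠ 0 → u j ≠ 0 → P.ord (u i) = P.ord (u j) → i = j) :
    ∑ i, u i ≠ 0 ∧ ∃ i, u i ≠ 0 ∧ P.ord (∑ i, u i) = P.ord (u i) ∧
      ∀ j, u j ≠ 0 → P.ord (u i) ≤ P.ord (u j) := by
  classical
  obtain ⟨i, hi, hmin⟩ := Finset.exists_min_image (Finset.univ.filter fun i => u i ≠ 0)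
    (fun i => P.ord (u i)) (by obtain ⟨i, hi⟩ := hne; exact ⟨i, by simpa using hi⟩)
  simp only [Finset.mem_filter, Finset.mem_univ, true_and] at hi hmin
  have hval : P.val (∑ i, u i) = P.val (u i) := by
    apply Valuation.map_sum_eq_of_lt _ (Finset.mem_univ i)
    intro j hj
    have hji : j ≠ i := by simpa using hj
    by_cases h0 : u j = 0
    · rw [h0, map_zero, zero_lt_iff]
      simpa using hi
    · rw [P.val_eq_exp h0, P.val_eq_exp hi, WithZero.exp_lt_exp]
      have h1 := hmin j h0
      have h2 : P.ord (u i) ≠ P.ord (u j) := fun h => hji (hinj _ _ hi h0 h).symm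
      omega
  refine ⟨?_, i, hi, ?_, hmin⟩
  · rw [← P.val.ne_zero_iff, hval]
    simpa using hi
  · rw [Place.ord, hval, Place.ord]

/-- A nontrivial `ℤ`-valued valuation that is trivial on the constants is a positive multiple of
a place. -/
theorem exists_place_of_valuation (w : Valuation F ℤᵐ⁰)
    (hK : ∀ a : K, a ≠ 0 → w (algebraMap K F a) = 1) (hw : ∃ z : F, z ≠ 0 ∧ w z ≠ 1) :
    ∃ R : Place K F, ∃ e : ℕ, 0 < e ∧ ∀ z, -WithZero.log (w z) = e * R.ord z := by
  classical
  have w0 : ∀ {z : F}, z ≠ 0 → w z ≠ 0 := fun hz => (Valuation.ne_zero_iff _).2 hz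
  -- The value group is a nonzero subgroup `eℤ` of `ℤ`; dividing by `e` normalizes the valuation.
  let G : AddSubgroup ℤ :=
    { carrier := {n | ∃ z : F, z ≠ 0 ∧ WithZero.log (w z) = n}
      zero_mem' := ⟨1, one_ne_zero, by simp⟩
      add_mem' := by
        rintro _ _ ⟨a, ha, rfl⟩ ⟨b, hb, rfl⟩
        exact ⟨a * b, mul_ne_zero ha hb, by rw [map_mul, WithZero.log_mul (w0 ha) (w0 hb)]⟩
      neg_mem' := by
        rintro _ ⟨a, ha, rfl⟩
        exact ⟨a⁻¹, inv_ne_zero ha, by rw [map_inv₀, WithZero.log_inv]⟩ }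
  obtain ⟨a, ha⟩ := Int.subgroup_cyclic G
  have hmem : ∀ n, n ∈ G ↔ a ∣ n := by
    intro n
    rw [ha, AddSubgroup.mem_closure_singleton]
    constructor
    · rintro ⟨k, rfl⟩
      exact ⟨k, by simp [mul_comm]⟩
    · rintro ⟨k, rfl⟩
      exact ⟨k, by simp [mul_comm]⟩
  have hdvd : ∀ z, z ≠ 0 → a ∣ WithZero.log (w z) := fun z hz => (hmem _).1 ⟨z, hz, rfl⟩
  have ha0 : a ≠ 0 := by
    rintro rfl
    obtain ⟨z, hz, hz1⟩ := hw
    have h1 := zero_dvd_iff.1 (hdvd z hz)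
    exact hz1 (by rw [← WithZero.exp_log (w0 hz), h1, WithZero.exp_zero])
  obtain ⟨e, he0, hae⟩ : ∃ e : ℕ, 0 < e ∧ ∀ n, n ∈ G ↔ (e : ℤ) ∣ n :=
    ⟨a.natAbs, Int.natAbs_pos.2 ha0, fun n => by rw [hmem, Int.natAbs_dvd]⟩
  have heZ : (0 : ℤ) < e := by exact_mod_cast he0
  choose! k hk using fun z (hz : z ≠ 0) => (hae _).1 ⟨z, hz, rfl⟩
  have hkmul : ∀ x y : F, x ≠ 0 → y ≠ 0 → k (x * y) = k x + k y := by
    intro x y hx hy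
    have h := hk _ (mul_ne_zero hx hy)
    rw [map_mul, WithZero.log_mul (w0 hx) (w0 hy), hk x hx, hk y hy, ← mul_add] at h
    exact (mul_left_cancel₀ heZ.ne' h).symm
  let v : Valuation F ℤᵐ⁰ :=
    { toFun := fun z => if z = 0 then 0 else WithZero.exp (k z)
      map_zero' := by simp
      map_one' := by
        have h := hk 1 one_ne_zero
        have : k 1 = 0 := by
          simp at h
          omega
        simp [this]
      map_mul' := by
        intro x y
        by_cases hx : x = 0
        · simp [hx]
        by_cases hy : y = 0
        · simp [hy]
        simp [hx, hy, hkmul x y hx hy, WithZero.exp_add]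
      map_add_le_max' := by
        intro x y
        by_cases hx : x = 0
        · simp [hx]
        by_cases hy : y = 0
        · simp [hy]
        by_cases hxy : x + y = 0
        · simp [hxy]
        simp only [hx, hy, hxy, if_false, le_max_iff, WithZero.exp_le_exp]
        have := w.map_add x y
        rw [le_max_iff, ← WithZero.log_le_log (w0 hxy) (w0 hx),
          ← WithZero.log_le_log (w0 hxy) (w0 hy), hk _ hx, hk _ hy, hk _ hxy] at this
        exact this.imp (fun h => le_of_mul_le_mul_left h heZ)
          (fun h => le_of_mul_le_mul_left h heZ) }
  have hv : ∀ z, v z = if z = 0 then 0 else WithZero.exp (k z) := fun z => rfl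
  refine ⟨⟨v, ?_, ?_⟩, e, he0, ?_⟩
  · intro γ
    by_cases hγ : γ = 0
    · exact ⟨0, by simp [hγ]⟩
    · obtain ⟨z, hz, hz1⟩ := (hae (e * WithZero.log γ)).2 (dvd_mul_right _ _)
      refine ⟨z, ?_⟩
      rw [hk z hz] at hz1
      rw [hv, if_neg hz, mul_left_cancel₀ heZ.ne' hz1, WithZero.exp_log hγ]
  · intro c hc
    have hc' : algebraMap K F c ≠ 0 := by simpa using hc
    have h := hk _ hc'
    rw [hK c hc, WithZero.log_one] at h
    have : k (algebraMap K F c) = 0 := by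
      rcases mul_eq_zero.1 h.symm with h | h
      · omega
      · exact h
    rw [hv, if_neg hc', this, WithZero.exp_zero]
  · intro z
    by_cases hz : z = 0
    · simp [hz]
    · rw [Place.ord, hv, if_neg hz, hk z hz, WithZero.log_exp]
      ring

end PlaceLemmas

/-! ### Places from primes of Dedekind domains -/

section DedekindPlaces

open IsDedekindDomain

variable {K F : Type*} [Field K] [Field F] [Algebra K F]

instance Place.isTrivialOn (P : Place K F) : P.val.IsTrivialOn K :=
  ⟨fun a ha => P.val_const a ha⟩

/-- The place of a nonzero prime of a Dedekind domain that contains the constants. -/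
noncomputable def Place.ofHeightOne {B : Type*} [CommRing B] [IsDedekindDomain B] [Algebra B F]
    [IsFractionRing B F] (hK : ∀ a : K, ∃ b : B, algebraMap B F b = algebraMap K F a)
    (v : HeightOneSpectrum B) : Place K F where
  val := v.valuation F
  surjective := v.valuation_surjective F
  val_const := by
    have hle : ∀ a : K, v.valuation F (algebraMap K F a) ≤ 1 := fun a => by
      obtain ⟨b, hb⟩ := hK a
      rw [← hb]
      exact v.valuation_le_one b
    intro a ha
    refine le_antisymm (hle a) ?_
    have h := hle a⁻¹
    have h0 : 0 < v.valuation F (algebraMap K F a) := by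
      rw [zero_lt_iff, Valuation.ne_zero_iff]
      simpa using ha
    rwa [map_inv₀, map_inv₀, inv_le_one₀ h0] at h

end DedekindPlaces

/-! ### Places and Riemann–Roch spaces of the rational function field -/

section RationalPlaces

open Polynomial IsDedekindDomain

variable {K : Type*} [Field K]

local notation "φ" => algebraMap (Polynomial K) (RatFunc K)

open Classical in
/-- The pole of `x`. -/
noncomputable def Place.infty (K : Type*) [Field K] : Place K (RatFunc K) where
  val := RatFunc.inftyValuation K
  surjective := by
    intro γ
    by_cases hγ : γ = 0
    · exact ⟨0, by simp [hγ]⟩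
    · exact ⟨RatFunc.X ^ WithZero.log γ, by
        rw [RatFunc.inftyValuation.X_zpow, WithZero.exp_log hγ]⟩
  val_const := fun a ha => RatFunc.inftyValuation.C K ha

theorem Place.ord_infty {z : RatFunc K} (hz : z ≠ 0) :
    (Place.infty K).ord z = -z.intDegree := by
  classical
  simp [Place.ord, Place.infty, RatFunc.inftyValuation_apply, hz]

theorem algebraMap_ratFunc_ne_zero {p : K[X]} (hp : p ≠ 0) : φ p ≠ 0 := by simpa using hp

/-- When `X` has a pole at `R`, the leading terms dominate: `ν_R(z) = deg(z) ν_R(X)` with `ν_R(X) <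
0`, so regularity at `R` means `deg z ≤ 0`. -/
theorem Place.eq_infty {R : Place K (RatFunc K)} (h : 1 < R.val RatFunc.X) :
    R = Place.infty K := by
  symm
  apply Place.eq_of_forall_ord_nonneg
  intro z hz h0
  have hX : R.ord RatFunc.X < 0 := by
    by_contra! hc
    exact absurd ((R.val_le_one_iff RatFunc.X_ne_zero).2 hc) (not_le.2 h)
  have h1 : R.ord z = z.intDegree * R.ord RatFunc.X := by
    rw [← R.ord_zpow, Place.ord, Place.ord,
      RatFunc.valuation_eq_valuation_X_zpow_intDegree_of_one_lt_valuation_X h hz, map_zpow₀]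
  have h2 : z.intDegree ≤ 0 := by
    by_contra! hc
    rw [h1] at h0
    nlinarith
  rw [Place.ord_infty hz]
  omega

theorem Place.val_X_le_one {R : Place K (RatFunc K)} (h : R ≠ Place.infty K) :
    R.val RatFunc.X ≤ 1 := by
  by_contra! hc
  exact h (Place.eq_infty hc)

theorem Place.ord_polynomial_nonneg {R : Place K (RatFunc K)} (h : R ≠ Place.infty K) (p : K[X]) :
    0 ≤ R.ord (φ p) := by
  by_cases hp : p = 0
  · simp [hp]
  · rw [← R.val_le_one_iff (algebraMap_ratFunc_ne_zero hp)]
    exact Polynomial.valuation_le_one_of_valuation_X_le_one _ (Place.val_X_le_one h) p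

theorem Place.ord_C (R : Place K (RatFunc K)) {a : K} (ha : a ≠ 0) : R.ord (φ (C a)) = 0 :=
  R.ord_const ha

theorem Place.infty_ord_X_sub_C (a : K) : (Place.infty K).ord (φ (X - C a)) = -1 := by
  rw [Place.ord_infty (algebraMap_ratFunc_ne_zero (X_sub_C_ne_zero a)),
    RatFunc.intDegree_polynomial]
  simp

theorem Place.ne_infty_of_ord_X_sub_C {R : Place K (RatFunc K)} {a : K}
    (h : 0 < R.ord (φ (X - C a))) : R ≠ Place.infty K := by
  rintro rfl
  rw [Place.infty_ord_X_sub_C] at h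
  omega

theorem Place.ord_pos_of_isRoot {R : Place K (RatFunc K)} {a : K}
    (h : 0 < R.ord (φ (X - C a))) {p : K[X]} (hp : p ≠ 0) (hpa : p.IsRoot a) :
    0 < R.ord (φ p) := by
  obtain ⟨g, rfl⟩ := dvd_iff_isRoot.2 hpa
  have := Place.ord_polynomial_nonneg (Place.ne_infty_of_ord_X_sub_C h) g
  rw [map_mul, R.ord_mul (algebraMap_ratFunc_ne_zero (left_ne_zero_of_mul hp))
    (algebraMap_ratFunc_ne_zero (right_ne_zero_of_mul hp))]
  omega

/-- The difference `p - p(a)` vanishes at `R`; if `p` did too, so would the nonzero constant `p(a)`.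
-/
theorem Place.ord_eq_zero_of_not_isRoot {R : Place K (RatFunc K)} {a : K}
    (h : 0 < R.ord (φ (X - C a))) {p : K[X]} (hpa : ¬ p.IsRoot a) :
    R.ord (φ p) = 0 := by
  refine le_antisymm ?_ (Place.ord_polynomial_nonneg (Place.ne_infty_of_ord_X_sub_C h) p)
  by_contra! hc
  by_cases hq : p - C (p.eval a) = 0
  · rw [sub_eq_zero.1 hq, R.ord_C hpa] at hc
    exact lt_irrefl _ hc
  have h1 : 0 < R.ord (φ (p - C (p.eval a))) :=
    Place.ord_pos_of_isRoot h hq (by simp)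
  have hC : φ (C (p.eval a)) ≠ 0 := algebraMap_ratFunc_ne_zero (by simpa using hpa)
  have hp : p ≠ 0 := by rintro rfl; simp at hpa
  have h2 : φ p + -φ (p - C (p.eval a)) = φ (C (p.eval a)) := by
    rw [← map_neg, ← map_add]; congr 1; ring
  have h3 := R.le_ord_add (c := 1) (algebraMap_ratFunc_ne_zero hp)
    (neg_ne_zero.2 (algebraMap_ratFunc_ne_zero hq)) (by rwa [h2]) (by omega)
    (by rw [R.ord_neg]; omega)
  rw [h2, R.ord_C hpa] at h3
  omega

/-- A place at which `x - a` vanishes is determined by `a`. -/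
theorem Place.eq_of_ord_X_sub_C_pos {R S : Place K (RatFunc K)} {a : K}
    (hR : 0 < R.ord (φ (X - C a))) (hS : 0 < S.ord (φ (X - C a))) : S = R := by
  apply Place.eq_of_forall_ord_nonneg
  intro z hz h0
  have hnum : z.num ≠ 0 := RatFunc.num_ne_zero hz
  have hden : z.denom ≠ 0 := z.denom_ne_zero
  have hord : ∀ T : Place K (RatFunc K), T.ord z = T.ord (φ z.num) - T.ord (φ z.denom) := by
    intro T
    conv_lhs => rw [← z.num_div_denom]
    rw [div_eq_mul_inv, T.ord_mul (algebraMap_ratFunc_ne_zero hnum)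
      (inv_ne_zero (algebraMap_ratFunc_ne_zero hden)), T.ord_inv]
    ring
  rw [hord] at h0 ⊢
  -- A denominator vanishing at `a` leaves, by coprimality, a numerator that is a unit at `R`,
  -- against regularity of `z`.
  by_cases hd : z.denom.IsRoot a
  · have h1 := Place.ord_pos_of_isRoot hR hden hd
    have h2 : ¬ z.num.IsRoot a := by
      intro h2
      obtain ⟨u, v, huv⟩ := z.isCoprime_num_denom
      have := congrArg (eval a) huv
      rw [IsRoot.def] at hd h2
      simp [hd, h2] at this
    have h3 := Place.ord_eq_zero_of_not_isRoot hR h2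
    omega
  · rw [Place.ord_eq_zero_of_not_isRoot hS hd]
    have := Place.ord_polynomial_nonneg (Place.ne_infty_of_ord_X_sub_C hS) z.num
    omega

/-- The finite places of `K(x)`. -/
noncomputable def Place.finite (v : HeightOneSpectrum K[X]) : Place K (RatFunc K) :=
  Place.ofHeightOne (fun a => ⟨C a, rfl⟩) v

theorem Place.finite_ne_infty (v : HeightOneSpectrum K[X]) : Place.finite v ≠ Place.infty K := by
  intro h
  have h1 : (Place.finite v).val (φ X) ≤ 1 := v.valuation_le_one X
  rw [(Place.finite v).val_le_one_iff (algebraMap_ratFunc_ne_zero X_ne_zero), h,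
    Place.ord_infty (algebraMap_ratFunc_ne_zero X_ne_zero), RatFunc.intDegree_polynomial] at h1
  simp at h1

/-- The zero of `x - a`. -/
noncomputable def Place.root (a : K) : Place K (RatFunc K) :=
  Place.finite
    { asIdeal := Ideal.span {X - C a}
      isPrime := (Ideal.span_singleton_prime (X_sub_C_ne_zero a)).2 (prime_X_sub_C a)
      ne_bot := by simpa using X_sub_C_ne_zero a }

theorem Place.root_ord_X_sub_C (a : K) : (Place.root a).ord (φ (X - C a)) = 1 := by
  rw [Place.ord, Place.root, Place.finite, Place.ofHeightOne]
  dsimp only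
  rw [HeightOneSpectrum.valuation_of_algebraMap,
    HeightOneSpectrum.intValuation_singleton _ (X_sub_C_ne_zero a) rfl, WithZero.log_exp]
  rfl

theorem Place.root_ne_infty (a : K) : Place.root a ≠ Place.infty K := Place.finite_ne_infty _

theorem Place.eq_root {R : Place K (RatFunc K)} {a : K} (h : 0 < R.ord (φ (X - C a))) :
    R = Place.root a :=
  Place.eq_of_ord_X_sub_C_pos (by rw [Place.root_ord_X_sub_C]; exact one_pos) h

open Classical in
theorem Place.ord_X_sub_C {R : Place K (RatFunc K)} (hR : R ≠ Place.infty K) (a : K) :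
    R.ord (φ (X - C a)) = if R = Place.root a then 1 else 0 := by
  split_ifs with h
  · rw [h, Place.root_ord_X_sub_C]
  · by_contra hc
    have := Place.ord_polynomial_nonneg hR (X - C a)
    exact h (Place.eq_root (by omega))

/-- A finite place at which a split polynomial has nonzero order is a root of it. -/
theorem Place.exists_eq_root_of_splits {f : K[X]} (hf : f.Splits) {R : Place K (RatFunc K)}
    (hR : R ≠ Place.infty K) (h : R.ord (φ f) ≠ 0) : ∃ a, R = Place.root a := by
  classical
  by_contra! hc
  have f0 : f ≠ 0 := by rintro rfl; simp at h
  apply h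
  have h1 : R.val (φ f) = 1 := by
    rw [hf.eq_prod_roots, map_mul, map_mul, map_multiset_prod, map_multiset_prod]
    have h2 : R.val (φ (C f.leadingCoeff)) = 1 :=
      R.val_const _ (leadingCoeff_ne_zero.2 f0)
    rw [h2, one_mul]
    apply Multiset.prod_eq_one
    intro x hx
    simp only [Multiset.map_map, Multiset.mem_map, Function.comp] at hx
    obtain ⟨a, -, rfl⟩ := hx
    rw [R.val_eq_exp (algebraMap_ratFunc_ne_zero (X_sub_C_ne_zero a)), Place.ord_X_sub_C hR,
      if_neg (hc a)]
    simp
  rw [Place.ord, h1, WithZero.log_one, neg_zero]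

/-- A rational function without finite poles is a polynomial. -/
theorem exists_polynomial_of_ord_nonneg {u : RatFunc K} (hu : u ≠ 0)
    (h : ∀ R : Place K (RatFunc K), R ≠ Place.infty K → 0 ≤ R.ord u) : ∃ p, φ p = u := by
  have := HeightOneSpectrum.mem_integers_of_valuation_le_one (R := K[X]) (RatFunc K) u
    (fun v => ((Place.finite v).val_le_one_iff hu).2 (h _ (Place.finite_ne_infty v)))
  simpa using this

/-- Riemann–Roch for `K(x)` and divisors supported at rational places. -/
theorem finrank_riemannRochSpace_ratFunc {ι : Type*} [Fintype ι]
    (P : ι → Place K (RatFunc K)) (k0 : ι) (hk0 : P k0 = Place.infty K)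
    (a : ι → K) (ha : ∀ k, k ≠ k0 → P k = Place.root (a k)) (c : ι → ℤ) :
    FiniteDimensional K (riemannRochSpace (∑ k, Finsupp.single (P k) (c k))) ∧
      Module.finrank K (riemannRochSpace (∑ k, Finsupp.single (P k) (c k))) =
        (1 + ∑ k, c k).toNat := by
  classical
  set D : Divisor K (RatFunc K) := ∑ k, Finsupp.single (P k) (c k) with hD
  have hDR : ∀ R, D R = ∑ k, if P k = R then c k else 0 := by
    intro R
    rw [hD, Finsupp.finsetSum_apply]
    simp only [Finsupp.single_apply]
  have hDinf : D (Place.infty K) = c k0 := by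
    rw [hDR, Finset.sum_eq_single k0 _ (by simp), if_pos hk0]
    intro k _ hk
    rw [if_neg]
    rw [ha k hk]
    exact Place.root_ne_infty _
  -- The divisor of `h` agrees with `D` away from infinity, so multiplication by `h` carries `ℒ(D)`
  -- onto the polynomials of degree at most `∑ c k`.
  set h : RatFunc K := ∏ k ∈ Finset.univ.erase k0, φ (X - C (a k)) ^ c k with hh
  have hlin : ∀ b : K, φ (X - C b) ≠ 0 := fun b => algebraMap_ratFunc_ne_zero (X_sub_C_ne_zero b)
  have h0 : h ≠ 0 := Finset.prod_ne_zero_iff.2 fun k _ => zpow_ne_zero _ (hlin _)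
  have hord : ∀ R : Place K (RatFunc K), R.ord h =
      ∑ k ∈ Finset.univ.erase k0, c k * R.ord (φ (X - C (a k))) := by
    intro R
    rw [hh, R.ord_prod _ _ fun k _ => zpow_ne_zero _ (hlin _)]
    simp only [R.ord_zpow]
  have hordfin : ∀ R : Place K (RatFunc K), R ≠ Place.infty K → R.ord h = D R := by
    intro R hR
    rw [hord, hDR, ← Finset.add_sum_erase _ _ (Finset.mem_univ k0), if_neg (by rw [hk0]; exact hR.symm),
      zero_add]
    refine Finset.sum_congr rfl fun k hk => ?_
    rw [Place.ord_X_sub_C hR, ha k (Finset.ne_of_mem_erase hk)]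
    by_cases hc : R = Place.root (a k)
    · simp [hc]
    · simp [hc, Ne.symm hc]
  have hordinf : (Place.infty K).ord h = c k0 - ∑ k, c k := by
    rw [hord, ← Finset.add_sum_erase _ c (Finset.mem_univ k0)]
    simp only [Place.infty_ord_X_sub_C]
    rw [← Finset.sum_mul]
    ring
  -- For a divisor of negative degree `toNat` gives `N = 0`, and the space is zero.
  set N := (1 + ∑ k, c k).toNat with hN
  let T : degreeLT K N →ₗ[K] RatFunc K :=
    (LinearMap.mulRight K h⁻¹).comp ((IsScalarTower.toAlgHom K K[X] (RatFunc K)).toLinearMap.comp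
      (degreeLT K N).subtype)
  have hT : ∀ p, T p = φ p * h⁻¹ := fun p => rfl
  have hTinj : Function.Injective T := by
    intro p q hpq
    rw [hT, hT] at hpq
    have := mul_right_cancel₀ (inv_ne_zero h0) hpq
    exact Subtype.ext (RatFunc.algebraMap_injective K this)
  have hrange : LinearMap.range T = riemannRochSpace D := by
    ext g
    constructor
    · rintro ⟨p, rfl⟩ hp0 R
      rw [hT] at hp0 ⊢
      have hφ := left_ne_zero_of_mul hp0
      have hp : (p : K[X]) ≠ 0 := by
        intro hp
        rw [hp, map_zero] at hφ
        exact hφ rfl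
      rw [R.ord_mul hφ (inv_ne_zero h0), R.ord_inv]
      by_cases hR : R = Place.infty K
      · rw [hR, hDinf, hordinf, Place.ord_infty hφ, RatFunc.intDegree_polynomial]
        have := mem_degreeLT.1 p.2
        rw [degree_eq_natDegree hp, Nat.cast_lt] at this
        omega
      · have := Place.ord_polynomial_nonneg hR (p : K[X])
        rw [hordfin R hR]
        omega
    · intro hg
      by_cases hg0 : g = 0
      · exact ⟨0, by rw [hg0, map_zero]⟩
      have hg' := hg hg0
      have hgh : g * h ≠ 0 := mul_ne_zero hg0 h0
      obtain ⟨p, hp⟩ := exists_polynomial_of_ord_nonneg hgh (fun R hR => by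
        rw [R.ord_mul hg0 h0, hordfin R hR]
        exact hg' R)
      have hp0 : p ≠ 0 := by
        rintro rfl
        rw [map_zero] at hp
        exact hgh hp.symm
      have h1 := hg' (Place.infty K)
      have h2 := Place.ord_infty hgh
      rw [(Place.infty K).ord_mul hg0 h0, hordinf, ← hp, RatFunc.intDegree_polynomial] at h2
      rw [hDinf] at h1
      refine ⟨⟨p, ?_⟩, ?_⟩
      · rw [mem_degreeLT, degree_eq_natDegree hp0, Nat.cast_lt]
        omega
      · rw [hT]
        dsimp only
        rw [hp, mul_assoc, mul_inv_cancel₀ h0, mul_one]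
  let e := LinearEquiv.ofInjective T hTinj
  rw [← hrange]
  have hfin : FiniteDimensional K (degreeLT K N) :=
    Module.Finite.equiv (degreeLTEquiv K N).symm
  refine ⟨Module.Finite.equiv e, ?_⟩
  rw [← e.finrank_eq, (degreeLTEquiv K N).finrank_eq, Module.finrank_fin_fun]

end RationalPlaces

/-! ### Totally ramified places and tame roots -/

section TotallyRamified

variable {K E F : Type*} [Field K] [Field E] [Field F] [Algebra K E] [Algebra K F] [Algebra E F]

theorem algebraMap_ne_zero_of_ne_zero {a : E} (ha : a ≠ 0) : algebraMap E F a ≠ 0 := by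
  simpa using ha

theorem Place.ord_sum_nonneg (Q : Place K F) {ι : Type*} (s : Finset ι) (u : ι → F)
    (hu : ∀ i ∈ s, u i ≠ 0 → 0 ≤ Q.ord (u i)) : 0 ≤ Q.ord (∑ i ∈ s, u i) := by
  by_cases h0 : ∑ i ∈ s, u i = 0
  · simp [h0]
  · rw [← Q.val_le_one_iff h0]
    apply Valuation.map_sum_le
    intro i hi
    by_cases hi0 : u i = 0
    · simp [hi0]
    · exact (Q.val_le_one_iff hi0).2 (hu i hi hi0)

theorem HasRamificationIndex.ord_smul {Q : Place K F} {P : Place K E} {e : ℕ}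
    (h : HasRamificationIndex Q P e) {a : E} (ha : a ≠ 0) {u : F} (hu : u ≠ 0) :
    Q.ord (a • u) = e * P.ord a + Q.ord u := by
  rw [Algebra.smul_def, Q.ord_mul (algebraMap_ne_zero_of_ne_zero ha) hu, h.2]

/-- A linear combination of elements whose orders are distinct modulo the ramification index. -/
theorem HasRamificationIndex.exists_ord_sum_smul_eq {Q : Place K F} {P : Place K E} {e : ℕ}
    (h : HasRamificationIndex Q P e) {ι : Type*} [Fintype ι] {u : ι → F} (hu : ∀ i, u i ≠ 0)
    (hinj : ∀ i j, (e : ℤ) ∣ Q.ord (u i) - Q.ord (u j) → i = j) {a : ι → E} (ha : ∃ i, a i ≠ 0) :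
    ∑ i, a i • u i ≠ 0 ∧ ∃ i, a i ≠ 0 ∧ Q.ord (∑ i, a i • u i) = e * P.ord (a i) + Q.ord (u i) ∧
      ∀ j, a j ≠ 0 → e * P.ord (a i) + Q.ord (u i) ≤ e * P.ord (a j) + Q.ord (u j) := by
  have hiff : ∀ i, a i • u i ≠ 0 ↔ a i ≠ 0 := fun i => by
    rw [smul_ne_zero_iff]
    exact and_iff_left (hu i)
  obtain ⟨h1, i, hi, h2, h3⟩ := Q.exists_ord_sum_eq (fun i => a i • u i)
    (by obtain ⟨i, hi⟩ := ha; exact ⟨i, (hiff i).2 hi⟩) (by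
      intro i j hi hj hij
      rw [h.ord_smul ((hiff i).1 hi) (hu i), h.ord_smul ((hiff j).1 hj) (hu j)] at hij
      exact hinj i j ⟨P.ord (a j) - P.ord (a i), by linear_combination hij⟩)
  rw [hiff] at hi
  refine ⟨h1, i, hi, ?_, ?_⟩
  · rw [h2, h.ord_smul hi (hu i)]
  · intro j hj
    rw [← h.ord_smul hi (hu i), ← h.ord_smul hj (hu j)]
    exact h3 j ((hiff j).2 hj)

theorem HasRamificationIndex.linearIndependent {Q : Place K F} {P : Place K E} {e : ℕ}
    (h : HasRamificationIndex Q P e) {ι : Type*} [Fintype ι] {u : ι → F} (hu : ∀ i, u i ≠ 0)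
    (hinj : ∀ i j, (e : ℤ) ∣ Q.ord (u i) - Q.ord (u j) → i = j) : LinearIndependent E u := by
  rw [Fintype.linearIndependent_iff]
  intro a ha
  by_contra! hc
  exact (h.exists_ord_sum_smul_eq hu hinj hc).1 ha

/-- Both orders are positive rescalings of `ν_Q` restricted to `E`, so they have the same sign. This
makes the `Q_k` distinct. -/
theorem HasRamificationIndex.place_below_unique {Q : Place K F} {P P' : Place K E} {e e' : ℕ}
    (h : HasRamificationIndex Q P e) (h' : HasRamificationIndex Q P' e') : P = P' := by
  apply Place.eq_of_forall_ord_nonneg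
  intro z _ h0
  have h1 := h.2 z
  rw [h'.2 z] at h1
  have he : (0 : ℤ) < e := by exact_mod_cast h.1
  have : 0 ≤ (e : ℤ) * P.ord z := by rw [← h1]; positivity
  exact nonneg_of_mul_nonneg_right this he

/-- At a totally ramified place, an element outside the base field can be approximated by the base
field up to an element whose order is not a multiple of the ramification index. -/
theorem IsTotallyRamified.exists_not_dvd_ord_sub {Q : Place K F} {P : Place K E}
    (h : IsTotallyRamified Q P) {w : F} (hw : ∀ b : E, algebraMap E F b ≠ w) :
    ∃ b : E, ¬ (Module.finrank E F : ℤ) ∣ Q.ord (w - algebraMap E F b) := by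
  have hr : HasRamificationIndex Q P (Module.finrank E F) := h
  set d := Module.finrank E F with hd
  have hd0 : 0 < d := hr.1
  have : NeZero d := ⟨hd0.ne'⟩
  obtain ⟨t, ht, ht1⟩ := Q.exists_ord_eq 1
  have hu : ∀ i : Fin d, t ^ (i : ℕ) ≠ 0 := fun i => pow_ne_zero _ ht
  have hou : ∀ i : Fin d, Q.ord (t ^ (i : ℕ)) = i := fun i => by rw [Q.ord_pow, ht1, mul_one]
  have hinj : ∀ i j : Fin d, (d : ℤ) ∣ Q.ord (t ^ (i : ℕ)) - Q.ord (t ^ (j : ℕ)) → i = j := by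
    intro i j hij
    rw [hou, hou] at hij
    have h1 := Int.eq_zero_of_abs_lt_dvd hij (by rw [abs_lt]; omega)
    exact Fin.ext (by omega)
  have hli := hr.linearIndependent hu hinj
  let B := basisOfLinearIndependentOfCardEqFinrank hli (by simp [hd])
  have hB : ∀ i, B i = t ^ (i : ℕ) := fun i => by simp [B]
  obtain ⟨c, hsum⟩ : ∃ c : Fin d → E, w = ∑ i, c i • t ^ (i : ℕ) := by
    refine ⟨B.repr w, ?_⟩
    conv_lhs => rw [← B.sum_repr w]
    simp only [hB]
  -- The powers `1, t, …, t^(d-1)` of a uniformizer form a basis. Removing the coefficient of `1`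
  -- leaves terms of order `i` modulo `d` with `i ≠ 0`.
  let a : Fin d → E := Function.update c 0 0
  have hsub : w - algebraMap E F (c 0) = ∑ i, a i • t ^ (i : ℕ) := by
    rw [hsum, ← Finset.add_sum_erase _ _ (Finset.mem_univ (0 : Fin d)),
      ← Finset.add_sum_erase _ (fun i => a i • t ^ (i : ℕ)) (Finset.mem_univ (0 : Fin d))]
    have h1 : ∑ i ∈ Finset.univ.erase (0 : Fin d), a i • t ^ (i : ℕ) =
        ∑ i ∈ Finset.univ.erase (0 : Fin d), c i • t ^ (i : ℕ) :=
      Finset.sum_congr rfl fun i hi => by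
        simp [a, Function.update_of_ne (Finset.ne_of_mem_erase hi)]
    rw [h1]
    simp [a, Algebra.smul_def]
  refine ⟨c 0, ?_⟩
  have ha : ∃ i, a i ≠ 0 := by
    by_contra! hc
    simp only [hc, zero_smul, Finset.sum_const_zero] at hsub
    exact hw _ (sub_eq_zero.1 hsub).symm
  obtain ⟨-, i, hi, h2, -⟩ := hr.exists_ord_sum_smul_eq hu hinj ha
  have hi0 : i ≠ 0 := by
    rintro rfl
    exact hi (by simp [a])
  rw [hsub, h2, hou]
  intro hdvd
  rw [dvd_add_right (dvd_mul_right _ _)] at hdvd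
  have h1 := Int.eq_zero_of_abs_lt_dvd hdvd (by rw [abs_lt]; omega)
  exact hi0 (Fin.ext (by simpa using h1))

/-- At a totally ramified place, a tame root of a local unit of the base field lies in the
base field. -/
theorem IsTotallyRamified.mem_range_of_pow_eq {Q : Place K F} {P : Place K E}
    (h : IsTotallyRamified Q P) {g : ℕ} (hg : (g : K) ≠ 0) {w : F} {u : E} (hu : u ≠ 0)
    (hu0 : P.ord u = 0) (hw : w ^ g = algebraMap E F u) : ∃ b : E, algebraMap E F b = w := by
  by_contra! hc
  obtain ⟨b, hb⟩ := h.exists_not_dvd_ord_sub hc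
  set d := Module.finrank E F
  have hr : HasRamificationIndex Q P d := h
  have hg0 : g ≠ 0 := by rintro rfl; simp at hg
  set δ := w - algebraMap E F b with hδ
  have hw0 : w ≠ 0 := by
    rintro rfl
    rw [zero_pow hg0] at hw
    exact algebraMap_ne_zero_of_ne_zero hu hw.symm
  have hδ0 : δ ≠ 0 := sub_ne_zero.2 (hc b).symm
  have hordw : Q.ord w = 0 := by
    have h1 : (g : ℤ) * Q.ord w = 0 := by rw [← Q.ord_pow, hw, hr.2, hu0, mul_zero]
    exact (mul_eq_zero.1 h1).resolve_left (by exact_mod_cast hg0)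
  have hvw : Q.val w = 1 := by rw [Q.val_eq_exp hw0, hordw]; simp
  have hb0 : b ≠ 0 := by
    rintro rfl
    apply hb
    rw [hδ, map_zero, sub_zero, hordw]
    exact dvd_zero _
  have hb0' : algebraMap E F b ≠ 0 := algebraMap_ne_zero_of_ne_zero hb0
  have hdb : (d : ℤ) ∣ Q.ord (algebraMap E F b) := ⟨_, hr.2 b⟩
  -- If `δ` were not in the maximal ideal, its order would be that of `b` or zero, both divisible by
  -- `d`.
  have hvδ : Q.val δ < 1 := by
    by_contra! hge
    rcases hge.lt_or_eq with hlt | heq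
    · have h1 : Q.val (algebraMap E F b) = Q.val δ := by
        have : algebraMap E F b = w - δ := by rw [hδ]; ring
        rw [this, Valuation.map_sub_eq_of_lt_right _ (by rwa [hvw])]
      apply hb
      rw [Place.ord, ← h1]
      exact hdb
    · apply hb
      rw [Place.ord, ← heq]
      simp
  have hvb : Q.val (algebraMap E F b) = 1 := by
    have : algebraMap E F b = w - δ := by rw [hδ]; ring
    rw [this, Valuation.map_sub_eq_of_lt_left _ (by rwa [hvw]), hvw]
  let b' : Q.val.integer := ⟨algebraMap E F b, hvb.le⟩
  let δ' : Q.val.integer := ⟨δ, hvδ.le⟩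
  -- Expanding `(b + δ)^g` gives `u - b^g = δ (g b^(g-1) + k δ)` with `k` integral at `Q`. The
  -- second factor is a unit because `g` is nonzero in `K`, so `δ` has the order of an element of
  -- `E`, a multiple of `d`.
  obtain ⟨k, hk⟩ := Polynomial.powAddExpansion b' δ' g
  have hk' := congrArg (fun x : Q.val.integer => (x : F)) hk
  simp only [Subring.coe_pow, Subring.coe_add, Subring.coe_mul, b', δ'] at hk'
  have hbδ : algebraMap E F b + δ = w := by rw [hδ]; ring
  rw [hbδ, hw] at hk'
  push_cast at hk'
  have hfac : algebraMap E F (u - b ^ g) =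
      δ * (g * algebraMap E F b ^ (g - 1) + k * δ) := by
    rw [map_sub, map_pow, hk']
    ring
  have hvg : Q.val (g : F) = 1 := by
    have := Q.val_const _ hg
    rwa [map_natCast] at this
  have hv1 : Q.val (g * algebraMap E F b ^ (g - 1) + k * δ) = 1 := by
    have h1 : Q.val (g * algebraMap E F b ^ (g - 1)) = 1 := by
      rw [map_mul, map_pow, hvg, hvb, one_pow, one_mul]
    rw [Valuation.map_add_eq_of_lt_left, h1]
    rw [h1, map_mul, mul_comm]
    exact mul_lt_one_of_lt_of_le hvδ k.2
  apply hb
  have h2 : Q.ord δ = Q.ord (algebraMap E F (u - b ^ g)) := by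
    rw [Place.ord, Place.ord, hfac, map_mul, hv1, mul_one]
  rw [h2, hr.2]
  exact dvd_mul_right _ _

end TotallyRamified

/-! ### Kummer generators at totally ramified places -/

section Kummer

variable {K E F : Type*} [Field K] [Field E] [Field F] [Algebra K E] [Algebra K F] [Algebra E F]
  {m : ℕ} {f : E} {y : F}

/-- With `g` the gcd, `λ = ν_P(f)` and `t` a uniformizer at `P`, the element `y^(m/g) t^(-λ/g)` is a
`g`-th root of the local unit `f t^(-λ)`, hence lies in `E`. So does `y^(m/g)`, and `f` is its
`g`-th power. -/
theorem IsTotallyRamified.gcd_ord_eq_one {Q : Place K F} {P : Place K E}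
    (h : IsTotallyRamified Q P) (hm : (m : K) ≠ 0) (hf : f ≠ 0)
    (hy : y ^ m = algebraMap E F f)
    (hpow : ∀ d : ℕ, 2 ≤ d → d ∣ m → ¬ ∃ g : E, g ^ d = f) : Int.gcd (P.ord f) m = 1 := by
  set g := Int.gcd (P.ord f) m with hg
  have hm0 : m ≠ 0 := by rintro rfl; simp at hm
  obtain ⟨l, hl⟩ : (g : ℤ) ∣ P.ord f := Int.gcd_dvd_left _ _
  obtain ⟨k, hk⟩ : g ∣ m := by
    have : (g : ℤ) ∣ m := Int.gcd_dvd_right _ _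
    exact_mod_cast this
  have hg0 : g ≠ 0 := by
    intro h0
    rw [h0, zero_mul] at hk
    exact hm0 hk
  have hgK : (g : K) ≠ 0 := by
    intro h0
    apply hm
    rw [hk, Nat.cast_mul, h0, zero_mul]
  obtain ⟨t, ht, ht1⟩ := P.exists_ord_eq 1
  have hz : ∀ n : ℤ, t ^ n ≠ 0 := fun n => zpow_ne_zero n ht
  obtain ⟨b, hb⟩ := h.mem_range_of_pow_eq (g := g) hgK
    (w := y ^ k * algebraMap E F (t ^ (-l))) (u := f * t ^ (-P.ord f))
    (mul_ne_zero hf (hz _)) (by rw [P.ord_mul hf (hz _), P.ord_zpow, ht1]; ring) (by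
      rw [mul_pow, ← pow_mul, mul_comm k g, ← hk, hy, ← map_pow, ← map_mul, ← zpow_natCast,
        ← zpow_mul, hl]
      congr 3
      ring)
  by_contra hg1
  refine hpow g (by omega) ⟨k, hk⟩ ⟨b * t ^ l, ?_⟩
  apply (algebraMap E F).injective
  have h1 : algebraMap E F (b * t ^ l) = y ^ k := by
    rw [map_mul, hb, mul_assoc, ← map_mul, ← zpow_add₀ ht]
    simp
  rw [map_pow, h1, ← pow_mul, mul_comm, ← hk, hy]

theorem kummer_ne_zero (hm : m ≠ 0) (hf : f ≠ 0) (hy : y ^ m = algebraMap E F f) : y ≠ 0 := by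
  rintro rfl
  rw [zero_pow hm] at hy
  exact algebraMap_ne_zero_of_ne_zero hf hy.symm

/-- The order of `a y⁻ⁱ`. -/
theorem HasRamificationIndex.ord_kummer {Q : Place K F} {P : Place K E} {e : ℕ}
    (h : HasRamificationIndex Q P e) (hm : m ≠ 0) (hf : f ≠ 0) (hy : y ^ m = algebraMap E F f)
    {a : E} (ha : a ≠ 0) (i : ℕ) :
    m * Q.ord (a • y⁻¹ ^ i) = e * (m * P.ord a - i * P.ord f) := by
  have hy0 := kummer_ne_zero hm hf hy
  have h1 : (m : ℤ) * Q.ord y = e * P.ord f := by rw [← Q.ord_pow, hy, h.2]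
  rw [h.ord_smul ha (pow_ne_zero _ (inv_ne_zero hy0)), Q.ord_pow, Q.ord_inv]
  linear_combination (-i : ℤ) * h1

theorem finrank_le_of_kummer (hm : m ≠ 0) (hy : y ^ m = algebraMap E F f)
    (hgen : IntermediateField.adjoin E {y} = ⊤) : Module.finrank E F ≤ m := by
  have hroot : Polynomial.aeval y (Polynomial.X ^ m - Polynomial.C f) = 0 := by simp [hy]
  have hmon : (Polynomial.X ^ m - Polynomial.C f).Monic := Polynomial.monic_X_pow_sub_C f hm
  have hint : IsIntegral E y := ⟨_, hmon, by rwa [Polynomial.aeval_def] at hroot⟩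
  rw [← IntermediateField.finrank_top', ← hgen, IntermediateField.adjoin.finrank hint]
  exact (Polynomial.natDegree_le_of_dvd (minpoly.dvd E y hroot) hmon.ne_zero).trans_eq
    Polynomial.natDegree_X_pow_sub_C

/-- From `m ν_Q(y) = [F : E] ν_P(f)` and coprimality, `m` divides `[F : E]`, which is at most `m`.
-/
theorem IsTotallyRamified.finrank_eq_of_kummer {Q : Place K F} {P : Place K E}
    (h : IsTotallyRamified Q P) (hm : (m : K) ≠ 0) (hf : f ≠ 0)
    (hy : y ^ m = algebraMap E F f)
    (hpow : ∀ d : ℕ, 2 ≤ d → d ∣ m → ¬ ∃ g : E, g ^ d = f)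
    (hgen : IntermediateField.adjoin E {y} = ⊤) : Module.finrank E F = m := by
  have hm0 : m ≠ 0 := by rintro rfl; simp at hm
  apply le_antisymm (finrank_le_of_kummer hm0 hy hgen)
  apply Nat.le_of_dvd h.1
  have h1 : (m : ℤ) * Q.ord y = Module.finrank E F * P.ord f := by rw [← Q.ord_pow, hy, h.2]
  have h2 : IsCoprime (m : ℤ) (P.ord f) := by
    rw [Int.isCoprime_iff_gcd_eq_one, Int.gcd_comm]
    exact h.gcd_ord_eq_one hm hf hy hpow
  exact_mod_cast h2.dvd_of_dvd_mul_right (Dvd.intro _ h1)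

/-- Powers of `y⁻¹` have distinct orders modulo `m`. -/
theorem HasRamificationIndex.kummer_ord_inj {Q : Place K F} {P : Place K E}
    (h : HasRamificationIndex Q P m) (hy : y ^ m = algebraMap E F f)
    (hgcd : Int.gcd (P.ord f) m = 1) (i j : Fin m)
    (hij : (m : ℤ) ∣ Q.ord (y⁻¹ ^ (i : ℕ)) - Q.ord (y⁻¹ ^ (j : ℕ))) : i = j := by
  have hm0 : (m : ℤ) ≠ 0 := by exact_mod_cast h.1.ne'
  have h1 : Q.ord y = P.ord f := by
    apply mul_left_cancel₀ hm0
    rw [← Q.ord_pow, hy, h.2]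
  rw [Q.ord_pow, Q.ord_pow, Q.ord_inv, h1, ← sub_mul] at hij
  have h2 : IsCoprime (m : ℤ) (-P.ord f) := by
    rw [IsCoprime.neg_right_iff, Int.isCoprime_iff_gcd_eq_one, Int.gcd_comm]
    exact hgcd
  have h3 := Int.eq_zero_of_abs_lt_dvd (h2.dvd_of_dvd_mul_right hij) (by rw [abs_lt]; omega)
  exact Fin.ext (by omega)

/-- The basis `1, y⁻¹, …, y⁻⁽ᵐ⁻¹⁾`. -/
theorem HasRamificationIndex.exists_kummer_basis {Q : Place K F} {P : Place K E}
    (h : HasRamificationIndex Q P m) (hf : f ≠ 0) (hy : y ^ m = algebraMap E F f)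
    (hgcd : Int.gcd (P.ord f) m = 1) (hfin : Module.finrank E F = m) :
    ∃ B : Module.Basis (Fin m) E F, ∀ i, B i = y⁻¹ ^ (i : ℕ) := by
  have hy0 := kummer_ne_zero h.1.ne' hf hy
  have : NeZero m := ⟨h.1.ne'⟩
  have hli := h.linearIndependent (u := fun i : Fin m => y⁻¹ ^ (i : ℕ))
    (fun i => pow_ne_zero _ (inv_ne_zero hy0)) (h.kummer_ord_inj hy hgcd)
  exact ⟨basisOfLinearIndependentOfCardEqFinrank hli (by simp [hfin]), fun i => by simp⟩

/-- The order of `∑ aᵢ y⁻ⁱ` at a totally ramified place bounds the orders of the terms. -/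
theorem HasRamificationIndex.le_ord_kummer_term {Q : Place K F} {P : Place K E}
    (h : HasRamificationIndex Q P m) (hf : f ≠ 0) (hy : y ^ m = algebraMap E F f)
    (hgcd : Int.gcd (P.ord f) m = 1) (a : Fin m → E) (j : Fin m) (hj : a j ≠ 0) :
    Q.ord (∑ i, a i • y⁻¹ ^ (i : ℕ)) ≤ m * P.ord (a j) - j * P.ord f := by
  have hy0 := kummer_ne_zero h.1.ne' hf hy
  have hm0 : (m : ℤ) ≠ 0 := by exact_mod_cast h.1.ne'
  obtain ⟨-, i, hi, h1, h2⟩ := h.exists_ord_sum_smul_eq (u := fun i : Fin m => y⁻¹ ^ (i : ℕ))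
    (fun i => pow_ne_zero _ (inv_ne_zero hy0)) (h.kummer_ord_inj hy hgcd) ⟨j, hj⟩
  rw [h1]
  refine (h2 j hj).trans_eq ?_
  rw [← h.ord_smul hj (pow_ne_zero _ (inv_ne_zero hy0))]
  exact mul_left_cancel₀ hm0 (h.ord_kummer h.1.ne' hf hy hj j)

/-- If `z` is regular at `Q`, so is each of its Kummer terms; up to a positive factor, the order of
a single term depends only on `P`, so the terms are regular at `Q'` as well. -/
theorem HasRamificationIndex.place_above_unique {Q Q' : Place K F} {P : Place K E} {e : ℕ}
    (h : HasRamificationIndex Q P m) (h' : HasRamificationIndex Q' P e) (hf : f ≠ 0)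
    (hy : y ^ m = algebraMap E F f)
    (hgcd : Int.gcd (P.ord f) m = 1) (hfin : Module.finrank E F = m) : Q' = Q := by
  obtain ⟨B, hB⟩ := h.exists_kummer_basis hf hy hgcd hfin
  have hm0 : (0 : ℤ) < m := by exact_mod_cast h.1
  apply Place.eq_of_forall_ord_nonneg
  intro z _ h0
  have hsum : z = ∑ i, B.repr z i • y⁻¹ ^ (i : ℕ) := by
    conv_lhs => rw [← B.sum_repr z]
    simp only [hB]
  rw [hsum] at h0 ⊢
  apply Place.ord_sum_nonneg
  intro i _ hi
  have hi0 := left_ne_zero_of_smul hi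
  have h1 := h.le_ord_kummer_term hf hy hgcd (B.repr z) i hi0
  have h2 := h'.ord_kummer h.1.ne' hf hy hi0 i
  have h3 : (0 : ℤ) ≤ m * Q'.ord (B.repr z i • y⁻¹ ^ (i : ℕ)) := by
    rw [h2]
    exact mul_nonneg (by positivity) (h0.trans h1)
  exact nonneg_of_mul_nonneg_right h3 hm0

end Kummer

/-! ### Regularity at places and integrality -/

section Integrality

open IsDedekindDomain

variable {K E F : Type*} [Field K] [Field E] [Field F] [Algebra K E] [Algebra K F] [Algebra E F]
  [IsScalarTower K E F]

/-- Over a Dedekind domain `A` containing the constants, an element of a finite separable extension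
of the fraction field that is regular at all places containing `A` is integral over `A`. -/
theorem isIntegral_of_forall_place [FiniteDimensional E F] [Algebra.IsSeparable E F]
    (A : Type*) [CommRing A] [IsDedekindDomain A] [Algebra A E] [IsFractionRing A E] [Algebra A F]
    [IsScalarTower A E F] (hK : ∀ a : K, ∃ b : A, algebraMap A E b = algebraMap K E a) (z : F)
    (hz : ∀ Q : Place K F, (∀ a : A, Q.val (algebraMap A F a) ≤ 1) → Q.val z ≤ 1) :
    IsIntegral A z := by
  have : IsDomain A := inferInstance
  -- The nonzero primes of the integral closure give places of `F` containing `A`, and regularity at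
  -- these already puts `z` in the closure.
  have : IsDedekindDomain (integralClosure A F) := integralClosure.isDedekindDomain A E F
  have : IsFractionRing (integralClosure A F) F :=
    integralClosure.isFractionRing_of_finite_extension E F
  have hK' : ∀ a : K, ∃ b : integralClosure A F,
      algebraMap (integralClosure A F) F b = algebraMap K F a := by
    intro a
    obtain ⟨b, hb⟩ := hK a
    refine ⟨algebraMap A _ b, ?_⟩
    rw [← IsScalarTower.algebraMap_apply A (integralClosure A F) F,
      IsScalarTower.algebraMap_apply A E F, hb, ← IsScalarTower.algebraMap_apply K E F]
  obtain ⟨b, hb⟩ := HeightOneSpectrum.mem_integers_of_valuation_le_one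
    (R := integralClosure A F) F z (fun v => hz (Place.ofHeightOne hK' v) (fun a => by
      rw [IsScalarTower.algebraMap_apply A (integralClosure A F) F]
      exact v.valuation_le_one _))
  rw [← hb]
  exact b.2

end Integrality

/-! ### Conjugates of a Kummer generator and integrality of terms -/

section KummerConjugates

variable {E F : Type*} [Field E] [Field F] [Algebra E F] {m : ℕ} {f : E} {y : F}

theorem isIntegral_of_kummer (hm : m ≠ 0) (hy : y ^ m = algebraMap E F f) : IsIntegral E y :=
  ⟨_, Polynomial.monic_X_pow_sub_C f hm, by simp [hy]⟩

theorem minpoly_of_kummer (hm : m ≠ 0) (hy : y ^ m = algebraMap E F f)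
    (hgen : IntermediateField.adjoin E {y} = ⊤) (hfin : Module.finrank E F = m) :
    minpoly E y = Polynomial.X ^ m - Polynomial.C f := by
  have hint := isIntegral_of_kummer hm hy
  refine (Polynomial.eq_of_monic_of_dvd_of_natDegree_le (minpoly.monic hint)
    (Polynomial.monic_X_pow_sub_C f hm) (minpoly.dvd E y (by simp [hy])) ?_).symm
  rw [← IntermediateField.adjoin.finrank hint, hgen, IntermediateField.finrank_top', hfin,
    Polynomial.natDegree_X_pow_sub_C]

theorem isSeparable_of_kummer (hm : (m : E) ≠ 0) (hf : f ≠ 0) (hy : y ^ m = algebraMap E F f)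
    (hgen : IntermediateField.adjoin E {y} = ⊤) (hfin : Module.finrank E F = m) :
    Algebra.IsSeparable E F := by
  have hm0 : m ≠ 0 := by rintro rfl; simp at hm
  have h1 : IsSeparable E y := by
    rw [IsSeparable, minpoly_of_kummer hm0 hy hgen hfin]
    exact Polynomial.separable_X_pow_sub_C f hm hf
  have h2 := (IntermediateField.isSeparable_adjoin_simple_iff_isSeparable E F).2 h1
  rw [hgen] at h2
  exact Algebra.IsSeparable.of_algHom E _ (IntermediateField.topEquiv (F := E) (E := F)).symm.toAlgHom

theorem exists_algHom_of_kummer [FiniteDimensional E F] {L : Type*} [Field L] [Algebra E L]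
    [IsAlgClosed L] (hm : m ≠ 0) (hy : y ^ m = algebraMap E F f)
    (hgen : IntermediateField.adjoin E {y} = ⊤) (hfin : Module.finrank E F = m) (w : L)
    (hw : w ^ m = algebraMap E L f) : ∃ σ : F →ₐ[E] L, σ y = w := by
  apply IntermediateField.exists_algHom_of_splits_of_aeval
    (fun s => ⟨Algebra.IsIntegral.isIntegral s, IsAlgClosed.splits _⟩)
  rw [minpoly_of_kummer hm hy hgen hfin]
  simp [hw]

/-- Orthogonality of characters: for `l ≠ i` this is a full geometric sum of ratio `ζ^(i-l) ≠ 1`. -/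
theorem sum_pow_mul_zpow_of_isPrimitiveRoot {L : Type*} [Field L] {ζ : L}
    (hζ : IsPrimitiveRoot ζ m) (i l : Fin m) :
    ∑ j ∈ Finset.range m, (ζ ^ j) ^ (i : ℕ) * ((ζ ^ j)⁻¹) ^ (l : ℕ) =
      if l = i then (m : L) else 0 := by
  have hm : 0 < m := i.pos
  have hζ0 : ζ ≠ 0 := hζ.ne_zero hm.ne'
  have h1 : ∀ j, (ζ ^ j) ^ (i : ℕ) * ((ζ ^ j)⁻¹) ^ (l : ℕ) = (ζ ^ ((i : ℤ) - l)) ^ j := by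
    intro j
    rw [zpow_sub₀ hζ0, zpow_natCast, zpow_natCast, div_pow, div_eq_mul_inv, inv_pow, ← pow_mul,
      ← pow_mul, ← pow_mul, ← pow_mul, mul_comm j, mul_comm j]
  simp only [h1]
  split_ifs with h
  · simp [h]
  · have hne : ζ ^ ((i : ℤ) - l) ≠ 1 := by
      rw [Ne, hζ.zpow_eq_one_iff_dvd]
      intro hd
      have := Int.eq_zero_of_abs_lt_dvd hd (by rw [abs_lt]; omega)
      exact h (Fin.ext (by omega))
    have h2 : (ζ ^ ((i : ℤ) - l)) ^ m = 1 := by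
      rw [← zpow_natCast, ← zpow_mul, mul_comm, zpow_mul, zpow_natCast, hζ.pow_eq_one, one_zpow]
    have h3 := mul_geom_sum (ζ ^ ((i : ℤ) - l)) m
    rw [h2, sub_self] at h3
    exact (mul_eq_zero.1 h3).resolve_left (sub_ne_zero.2 hne)

/-- The field `F` may lack `m`-th roots of unity, so the embeddings `y ↦ ζ^j y` go into `L`.
Weighting the conjugates of the sum by `ζ^(ij)` and adding isolates `m` times the `i`-th term;
everything used is integral, and `m` is a unit. -/
theorem isIntegral_kummer_term_of_isAlgClosed (L : Type*) [Field L] [IsAlgClosed L] [Algebra F L]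
    [Algebra E L] [IsScalarTower E F L] [FiniteDimensional E F] (A : Type*) [CommRing A] [Algebra A E]
    [Algebra A F] [IsScalarTower A E F] [Algebra A L] [IsScalarTower A F L] (hmA : IsUnit (m : A)) (hm : (m : E) ≠ 0)
    (hy : y ^ m = algebraMap E F f) (hgen : IntermediateField.adjoin E {y} = ⊤)
    (hfin : Module.finrank E F = m) (a : Fin m → E)
    (hz : IsIntegral A (∑ i, a i • y⁻¹ ^ (i : ℕ))) (i : Fin m) :
    IsIntegral A (a i • y⁻¹ ^ (i : ℕ)) := by
  have hm0 : m ≠ 0 := by rintro rfl; simp at hm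
  have : NeZero m := ⟨hm0⟩
  have : IsScalarTower A E L := IsScalarTower.of_algebraMap_eq fun x => by
    rw [IsScalarTower.algebraMap_apply E F L, ← IsScalarTower.algebraMap_apply A E F,
      ← IsScalarTower.algebraMap_apply A F L]
  have hmL : (m : L) ≠ 0 := by
    rw [← map_natCast (algebraMap E L)]
    exact algebraMap_ne_zero_of_ne_zero hm
  have : NeZero (m : L) := ⟨hmL⟩
  obtain ⟨ζ, hζ⟩ := HasEnoughRootsOfUnity.exists_primitiveRoot L m
  have hζ0 : ζ ≠ 0 := hζ.ne_zero hm0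
  set η : L := algebraMap F L y with hη
  have hηm : η ^ m = algebraMap E L f := by
    rw [hη, ← map_pow, hy, ← IsScalarTower.algebraMap_apply]
  choose σ hσ using fun j : ℕ => exists_algHom_of_kummer (L := L) hm0 hy hgen hfin (ζ ^ j * η) (by
    rw [mul_pow, hηm, ← pow_mul, mul_comm j, pow_mul, hζ.pow_eq_one, one_pow, one_mul])
  have hσz : ∀ j, σ j (∑ l : Fin m, a l • y⁻¹ ^ (l : ℕ)) =
      ∑ l : Fin m, ((ζ ^ j)⁻¹) ^ (l : ℕ) * algebraMap F L (a l • y⁻¹ ^ (l : ℕ)) := by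
    intro j
    rw [map_sum]
    refine Finset.sum_congr rfl fun l _ => ?_
    rw [Algebra.smul_def, map_mul, map_mul, map_pow, map_pow, map_inv₀, map_inv₀, hσ,
      AlgHom.commutes, ← IsScalarTower.algebraMap_apply, mul_inv, mul_pow]
    ring
  have hsum : ∑ j ∈ Finset.range m, (ζ ^ j) ^ (i : ℕ) * σ j (∑ l : Fin m, a l • y⁻¹ ^ (l : ℕ)) =
      m * algebraMap F L (a i • y⁻¹ ^ (i : ℕ)) := by
    simp only [hσz, Finset.mul_sum, ← mul_assoc]
    rw [Finset.sum_comm]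
    simp only [← Finset.sum_mul, sum_pow_mul_zpow_of_isPrimitiveRoot hζ]
    simp
  have hζint : IsIntegral A ζ := by
    refine IsIntegral.of_pow (Nat.pos_of_ne_zero hm0) ?_
    rw [hζ.pow_eq_one]
    exact isIntegral_one
  have hint : IsIntegral A (m * algebraMap F L (a i • y⁻¹ ^ (i : ℕ))) := by
    rw [← hsum]
    refine IsIntegral.sum _ fun j _ => ((hζint.pow _).pow _).mul ?_
    exact hz.map ((σ j).restrictScalars A)
  obtain ⟨u, hu⟩ := hmA.exists_right_inv
  have hint2 : IsIntegral A (algebraMap F L (a i • y⁻¹ ^ (i : ℕ))) := by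
    have h1 := (isIntegral_algebraMap (R := A) (A := L) (x := u)).mul hint
    have h2 : algebraMap A L u * m = 1 := by
      have := congrArg (algebraMap A L) hu
      rwa [map_mul, map_natCast, map_one, mul_comm] at this
    rwa [← mul_assoc, h2, one_mul] at h1
  exact (isIntegral_algebraMap_iff (algebraMap F L).injective).1 hint2

/-- If `∑ aᵢ y⁻ⁱ` is integral over `A` and `m` is a unit of `A`, then every term is integral. -/
theorem isIntegral_kummer_term [FiniteDimensional E F] (A : Type*) [CommRing A] [Algebra A E]
    [Algebra A F] [IsScalarTower A E F] (hmA : IsUnit (m : A)) (hm : (m : E) ≠ 0)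
    (hy : y ^ m = algebraMap E F f) (hgen : IntermediateField.adjoin E {y} = ⊤)
    (hfin : Module.finrank E F = m) (a : Fin m → E)
    (hz : IsIntegral A (∑ i, a i • y⁻¹ ^ (i : ℕ))) (i : Fin m) :
    IsIntegral A (a i • y⁻¹ ^ (i : ℕ)) :=
  isIntegral_kummer_term_of_isAlgClosed (AlgebraicClosure F) A hmA hm hy hgen hfin a hz i

theorem kummer_term_pow (hy : y ^ m = algebraMap E F f) (a : E) (i : ℕ) :
    (a • y⁻¹ ^ i) ^ m = algebraMap E F (a ^ m * f⁻¹ ^ i) := by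
  rw [Algebra.smul_def, mul_pow, ← pow_mul, mul_comm i, pow_mul, inv_pow, hy, map_mul, map_pow,
    map_pow, map_inv₀]

end KummerConjugates

/-! ### Local conditions at an arbitrary place below -/

section Unramified

variable {K E F : Type*} [Field K] [Field E] [Field F] [Algebra K E] [Algebra K F] [Algebra E F]
  [IsScalarTower K E F] {m : ℕ} {f : E} {y : F}

theorem Place.isDiscreteValuationRing (R : Place K E) :
    IsDiscreteValuationRing R.val.valuationSubring := by
  obtain ⟨t, ht, ht1⟩ := R.exists_ord_eq 1
  have : R.val.IsNontrivial := ⟨t, by simpa using ht, by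
    intro h
    rw [Place.ord, h] at ht1
    simp at ht1⟩
  infer_instance

/-- If `∑ aᵢ y⁻ⁱ` is regular at all places that are regular on `O_R`, then so is every term. -/
theorem kummer_term_ord_nonneg (R : Place K E) (hm : (m : K) ≠ 0) (hf : f ≠ 0)
    (hy : y ^ m = algebraMap E F f) (hgen : IntermediateField.adjoin E {y} = ⊤)
    (hfin : Module.finrank E F = m) (a : Fin m → E)
    (hz : ∀ Q : Place K F, (∀ x : E, x ≠ 0 → 0 ≤ R.ord x → 0 ≤ Q.ord (algebraMap E F x)) →
      0 ≤ Q.ord (∑ i, a i • y⁻¹ ^ (i : ℕ))) (i : Fin m) (hi : a i ≠ 0) :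
    0 ≤ m * R.ord (a i) - i * R.ord f := by
  have hm0 : m ≠ 0 := by rintro rfl; simp at hm
  have hmE : (m : E) ≠ 0 := by
    rw [← map_natCast (algebraMap K E)]
    exact algebraMap_ne_zero_of_ne_zero hm
  have : FiniteDimensional E F := Module.finite_of_finrank_pos (by omega)
  have := isSeparable_of_kummer hmE hf hy hgen hfin
  let A := R.val.valuationSubring
  have : IsDiscreteValuationRing A := R.isDiscreteValuationRing
  let _ : Algebra A F := ((algebraMap E F).comp (algebraMap A E)).toAlgebra
  have : IsScalarTower A E F := IsScalarTower.of_algebraMap_eq fun _ => rfl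
  have hconst : ∀ b : K, R.val (algebraMap K E b) ≤ 1 := fun b => by
    by_cases hb : b = 0
    · simp [hb]
    · exact (R.val_const b hb).le
  have hint : IsIntegral A (∑ i, a i • y⁻¹ ^ (i : ℕ)) := by
    refine isIntegral_of_forall_place (K := K) (E := E) A
      (fun b => ⟨⟨algebraMap K E b, hconst b⟩, rfl⟩) _ fun Q hQ => ?_
    by_cases h0 : ∑ i, a i • y⁻¹ ^ (i : ℕ) = 0
    · rw [h0, map_zero]
      exact zero_le_one
    rw [Q.val_le_one_iff h0]
    refine hz Q fun x hx hx0 => ?_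
    rw [← Q.val_le_one_iff (algebraMap_ne_zero_of_ne_zero hx)]
    exact hQ ⟨x, (R.val_le_one_iff hx).2 hx0⟩
  have hmA : IsUnit (m : A) := by
    refine IsUnit.of_mul_eq_one ⟨algebraMap K E (m : K)⁻¹, hconst _⟩ (Subtype.ext ?_)
    change ((m : A) : E) * algebraMap K E (m : K)⁻¹ = 1
    rw [map_inv₀, map_natCast]
    exact mul_inv_cancel₀ hmE
  -- The `m`-th power of the term is `aᵢ^m f⁻ⁱ`, an element of `E`, and `O_R` is integrally closed.
  have h1 := (isIntegral_kummer_term A hmA hmE hy hgen hfin a hint i).pow m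
  rw [kummer_term_pow hy, isIntegral_algebraMap_iff (algebraMap E F).injective] at h1
  obtain ⟨b, hb⟩ := IsIntegrallyClosed.isIntegral_iff.1 h1
  have h2 : R.val (a i ^ m * f⁻¹ ^ (i : ℕ)) ≤ 1 := by
    rw [← hb]
    exact b.2
  have h3 : f⁻¹ ^ (i : ℕ) ≠ 0 := pow_ne_zero _ (inv_ne_zero hf)
  rw [R.val_le_one_iff (mul_ne_zero (pow_ne_zero _ hi) h3), R.ord_mul (pow_ne_zero _ hi) h3,
    R.ord_pow, R.ord_pow, R.ord_inv] at h2
  linarith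

end Unramified

/-! ### Splitting Riemann–Roch spaces along a basis; places below -/

section Decomposition

theorem sum_single_apply_of_injective {ι X : Type*} [Fintype ι] {P : ι → X}
    (hP : Function.Injective P) (c : ι → ℤ) (k : ι) :
    (∑ j, Finsupp.single (P j) (c j)) (P k) = c k := by
  classical
  rw [Finsupp.finsetSum_apply, Finset.sum_eq_single k _ (by simp), Finsupp.single_eq_same]
  intro j _ hj
  exact Finsupp.single_eq_of_ne' (hP.ne hj)

theorem sum_single_apply_of_forall_ne {ι X : Type*} [Fintype ι] {P : ι → X} (c : ι → ℤ) {R : X}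
    (hR : ∀ k, P k ≠ R) : (∑ j, Finsupp.single (P j) (c j)) R = 0 := by
  rw [Finsupp.finsetSum_apply]
  exact Finset.sum_eq_zero fun j _ => Finsupp.single_eq_of_ne' (hR j)

variable {K E F : Type*} [Field K] [Field E] [Field F] [Algebra K E] [Algebra K F] [Algebra E F]
  [IsScalarTower K E F]

/-- If `ℒ(D)` is cut out by conditions on the coordinates in a basis, it is a direct product. -/
theorem finrank_riemannRochSpace_of_basis {ι : Type*} [Fintype ι] (B : Module.Basis ι E F)
    (D : Divisor K F) (D' : ι → Divisor K E)
    (hD : ∀ z, z ∈ riemannRochSpace D ↔ ∀ i, B.repr z i ∈ riemannRochSpace (D' i))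
    (hfin : ∀ i, FiniteDimensional K (riemannRochSpace (D' i))) :
    FiniteDimensional K (riemannRochSpace D) ∧
      Module.finrank K (riemannRochSpace D) =
        ∑ i, Module.finrank K (riemannRochSpace (D' i)) := by
  let e : riemannRochSpace D ≃ₗ[K] ∀ i, riemannRochSpace (D' i) :=
    { toFun := fun z i => ⟨B.repr z i, (hD z).1 z.2 i⟩
      map_add' := fun z w => by ext i; simp
      map_smul' := fun c z => by
        ext i
        change B.repr (c • (z : F)) i = c • B.repr (z : F) i
        rw [← algebraMap_smul E c (z : F), map_smul, Finsupp.smul_apply, algebraMap_smul]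
      invFun := fun a => ⟨B.equivFun.symm fun i => (a i : E), (hD _).2 fun i => by
        rw [← B.equivFun_apply, LinearEquiv.apply_symm_apply]
        exact (a i).2⟩
      left_inv := fun z => by
        apply Subtype.ext
        exact B.equivFun.symm_apply_apply (z : F)
      right_inv := fun a => by
        ext i
        exact congrFun (B.equivFun.apply_symm_apply fun i => (a i : E)) i }
  exact ⟨Module.Finite.equiv e.symm, by rw [e.finrank_eq, Module.finrank_pi_fintype]⟩

/-- A place of `F` restricts to the base field trivially or to a multiple of a place. -/
theorem Place.exists_place_below (Q : Place K F) :
    (∀ x : E, Q.ord (algebraMap E F x) = 0) ∨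
      ∃ (R : Place K E) (e : ℕ), HasRamificationIndex Q R e := by
  by_cases h : ∃ z : E, z ≠ 0 ∧ Q.val (algebraMap E F z) ≠ 1
  · right
    obtain ⟨R, e, he, hR⟩ := exists_place_of_valuation (K := K) (Q.val.comap (algebraMap E F))
      (fun a ha => by
        rw [Valuation.comap_apply, ← IsScalarTower.algebraMap_apply]
        exact Q.val_const a ha) h
    exact ⟨R, e, he, hR⟩
  · left
    push Not at h
    intro x
    by_cases hx : x = 0
    · simp [hx]
    · rw [Place.ord, h x hx, WithZero.log_one, neg_zero]

end Decomposition

/-! ### Riemann–Roch conditions on Kummer coordinates -/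

section KummerSpaces

variable {K E F : Type*} [Field K] [Field E] [Field F] [Algebra K E] [Algebra K F] [Algebra E F]
  [IsScalarTower K E F] {m : ℕ} {f : E} {y : F}

/-- `∑ aᵢ y⁻ⁱ` lies in `ℒ(D)`, for `D` supported at totally ramified places, exactly when every
`aᵢ` lies in a Riemann–Roch space of the base field. -/
theorem mem_riemannRochSpace_kummer (hm : (m : K) ≠ 0) (hf : f ≠ 0)
    (hy : y ^ m = algebraMap E F f) (hgen : IntermediateField.adjoin E {y} = ⊤)
    (hfin : Module.finrank E F = m) {κ : Type*} [Fintype κ] {Q : κ → Place K F}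
    {P : κ → Place K E} (hQinj : Function.Injective Q)
    (hQ : ∀ k, HasRamificationIndex (Q k) (P k) m) (hgcd : ∀ k, Int.gcd ((P k).ord f) m = 1)
    (α : κ → ℤ) (B : Module.Basis (Fin m) E F) (hB : ∀ i, B i = y⁻¹ ^ (i : ℕ))
    (D' : Fin m → Divisor K E)
    (hD1 : ∀ i k, D' i (P k) = (α k - (i : ℕ) * (P k).ord f) / m)
    (hD2 : ∀ i R, (∀ k, P k ≠ R) → D' i R = (-((i : ℕ) * R.ord f)) / m) (z : F) :
    z ∈ riemannRochSpace (∑ k, Finsupp.single (Q k) (α k)) ↔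
      ∀ i, B.repr z i ∈ riemannRochSpace (D' i) := by
  have hm0 : m ≠ 0 := by rintro rfl; simp at hm
  have hmpos : (0 : ℤ) < m := by exact_mod_cast Nat.pos_of_ne_zero hm0
  have hy0 := kummer_ne_zero hm0 hf hy
  have hsum : z = ∑ i, B.repr z i • y⁻¹ ^ (i : ℕ) := by
    conv_lhs => rw [← B.sum_repr z]
    simp only [hB]
  have hdiv : ∀ o c : ℤ, 0 ≤ o + c / m ↔ 0 ≤ m * o + c := by
    intro o c
    have := Int.le_ediv_iff_mul_le (a := -o) (b := c) hmpos
    constructor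
    · intro h
      have := this.1 (by omega)
      linarith
    · intro h
      have := this.2 (by linarith)
      omega
  constructor
  · intro hz i hi R
    have hz0 : z ≠ 0 := by
      rintro rfl
      simp at hi
    have hz' := hz hz0
    by_cases hR : ∃ k, P k = R
    · obtain ⟨k, rfl⟩ := hR
      have h1 := hz' (Q k)
      rw [sum_single_apply_of_injective hQinj] at h1
      have h2 := (hQ k).le_ord_kummer_term hf hy (hgcd k) (B.repr z) i hi
      rw [← hsum] at h2
      rw [hD1, hdiv]
      linarith
    · push Not at hR
      rw [hD2 i R hR, hdiv]
      have := kummer_term_ord_nonneg R hm hf hy hgen hfin (B.repr z) (fun Q' hQ' => by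
        rw [← hsum]
        have h1 := hz' Q'
        rwa [sum_single_apply_of_forall_ne, add_zero] at h1
        -- A place regular on `O_R` cannot be some `Q_k`, since then `P_k = R`; so the divisor
        -- vanishes there.
        rintro k rfl
        apply hR k
        apply Place.eq_of_forall_ord_nonneg
        intro x hx hx0
        have h2 := hQ' x hx hx0
        rw [(hQ k).2] at h2
        exact nonneg_of_mul_nonneg_right h2 hmpos) i hi
      linarith
  · intro ha
    rw [hsum]
    refine Submodule.sum_mem _ fun i _ hi Q' => ?_
    have hi0 := left_ne_zero_of_smul hi
    have ha' := ha i hi0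
    by_cases hQ' : ∃ k, Q k = Q'
    · obtain ⟨k, rfl⟩ := hQ'
      have h1 := mul_left_cancel₀ hmpos.ne' ((hQ k).ord_kummer hm0 hf hy hi0 i)
      have h2 := ha' (P k)
      rw [hD1, hdiv] at h2
      rw [sum_single_apply_of_injective hQinj, h1]
      linarith
    · push Not at hQ'
      rw [sum_single_apply_of_forall_ne _ hQ', add_zero]
      suffices h : 0 ≤ (m : ℤ) * Q'.ord (B.repr z i • y⁻¹ ^ (i : ℕ)) from
        nonneg_of_mul_nonneg_right h hmpos
      rcases Q'.exists_place_below (E := E) with h0 | ⟨R, e, hR⟩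
      -- If `Q'` is trivial on `E`, the term has order zero because its `m`-th power lies in `E`.
      · rw [← Q'.ord_pow, kummer_term_pow hy, h0]
      · rw [hR.ord_kummer hm0 hf hy hi0]
        have h1 := ha' R
        rw [hD2 i R, hdiv] at h1
        · exact mul_nonneg (by positivity) (by linarith)
        -- `Q_k` is the only place above `P_k`, so `R` is none of the `P_k`.
        · rintro k rfl
          exact hQ' k ((hQ k).place_above_unique hR hf hy (hgcd k) hfin).symm

end KummerSpaces

/-! ### Floor and ceiling arithmetic -/

section Arithmetic

theorem Fin.sum_eq_sum_castLE {n r : ℕ} (h : n ≤ r) (g : Fin r → ℤ)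
    (hg : ∀ k : Fin r, n ≤ k → g k = 0) : ∑ k, g k = ∑ k : Fin n, g (Fin.castLE h k) := by
  obtain ⟨s, rfl⟩ := Nat.exists_eq_add_of_le h
  rw [Fin.sum_univ_add]
  have : ∑ i : Fin s, g (Fin.natAdd n i) = 0 := Finset.sum_eq_zero fun i _ => hg _ (by simp)
  rw [this, add_zero]
  rfl

/-- As `m ∤ x`, the ceiling of `x / m` exceeds its floor by one. Summed over the `n` ramified
places, these ones give the `n` of the formula. -/
theorem ediv_sub_add_ceil {m : ℕ} {x : ℤ} (hx : ¬ (m : ℤ) ∣ x) (hm : 0 < m) (a : ℤ) :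
    (a - x) / m - -x / m = 1 + (a - x % m) / m := by
  have hm' : (0 : ℤ) < m := by exact_mod_cast hm
  have h1 : a - x = (a - x % m) + m * (-(x / m)) := by
    have := Int.emod_add_mul_ediv x m
    linarith
  have h2 : -x / (m : ℤ) = -(x / m) - 1 := by
    have h3 := Int.emod_add_mul_ediv x m
    have h4 : 0 < x % m := lt_of_le_of_ne (Int.emod_nonneg _ hm'.ne')
      (fun h => hx (Int.dvd_of_emod_eq_zero h.symm))
    have h5 := Int.emod_lt_of_pos x hm'
    rw [Int.ediv_eq_iff_of_pos hm']
    constructor <;> linarith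
  rw [h1, Int.add_mul_ediv_left _ _ hm'.ne', h2]
  ring

/-- The floor–ceiling identity relating the local conditions to `β` and `t`. -/
theorem kummer_floor_identity {m n r : ℕ} (hm : 0 < m) (hnr : n ≤ r) (lam : Fin r → ℤ)
    (α' : Fin r → ℤ) (α : Fin n → ℤ) (hα : ∀ k, α' (Fin.castLE hnr k) = α k)
    (hα0 : ∀ k : Fin r, n ≤ k → α' k = 0)
    (hgcd : ∀ k : Fin n, Int.gcd (lam (Fin.castLE hnr k)) m = 1) {i : ℕ} (hi : 0 < i)
    (him : i < m) :
    1 + ∑ k, (α' k - i * lam k) / m = (n : ℤ) - kummerBeta m lam i +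
      ∑ k : Fin n, ⌊((α k - kummerT m (lam (Fin.castLE hnr k)) i : ℤ) : ℚ) / (m : ℚ)⌋ := by
  have hceil : ∀ k, ⌈((i : ℚ) * (lam k : ℚ)) / (m : ℚ)⌉ = -(-(i * lam k) / (m : ℤ)) := by
    intro k
    rw [← Rat.ceil_intCast_div_natCast]
    push_cast
    rfl
  -- Subtracting the ceiling terms of `β` at all `r` places kills the places beyond the `n`-th,
  -- where `α'` is zero.
  have hmain : ∑ k, ((α' k - i * lam k) / m - -(i * lam k) / (m : ℤ)) =
      ∑ k : Fin n, (1 + (α k - kummerT m (lam (Fin.castLE hnr k)) i) / m) := by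
    rw [Fin.sum_eq_sum_castLE hnr]
    · refine Finset.sum_congr rfl fun k _ => ?_
      rw [hα, kummerT, ediv_sub_add_ceil _ hm]
      intro hd
      have h1 : IsCoprime (m : ℤ) (lam (Fin.castLE hnr k)) := by
        rw [Int.isCoprime_iff_gcd_eq_one, Int.gcd_comm]
        exact hgcd k
      have := Int.le_of_dvd (by exact_mod_cast hi) (h1.dvd_of_dvd_mul_right hd)
      omega
    · intro k hk
      rw [hα0 k hk, zero_sub, sub_self]
  rw [Finset.sum_sub_distrib, Finset.sum_add_distrib] at hmain
  simp only [Finset.sum_const, Finset.card_univ, Fintype.card_fin, nsmul_eq_mul, mul_one] at hmain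
  simp only [kummerBeta, hceil, Rat.floor_intCast_div_natCast, Finset.sum_neg_distrib]
  linarith

end Arithmetic

end AlgFun

/-! ### The dimension formula -/

open AlgFun in
theorem mainTheorem1 {K F : Type*} [Field K] [Finite K] [Field F]
    [Algebra K F] [Algebra (RatFunc K) F] [IsScalarTower K (RatFunc K) F]
    -- the Kummer extension `F = K(x)(y)`, `y ^ m = f(x)`
    (m : ℕ) (hm : 2 ≤ m) (hchar : ¬ ringChar K ∣ m)
    (f : Polynomial K) (hdeg : 2 ≤ f.natDegree)
    (hpow : ∀ d : ℕ, 2 ≤ d → d ∣ m →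
      ¬ ∃ g : RatFunc K, g ^ d = algebraMap (Polynomial K) (RatFunc K) f)
    (hroots : f.Splits)
    (y : F)
    (hy : y ^ m = algebraMap (RatFunc K) F (algebraMap (Polynomial K) (RatFunc K) f))
    (hgen : IntermediateField.adjoin (RatFunc K) {y} = ⊤)
    -- `P_1, …, P_r` are the distinct zeros and poles of `f` in `K(x)`,
    -- and `lam k` is the order of `f` at `P_k`
    (r : ℕ) (P : Fin r → AlgFun.Place K (RatFunc K)) (hPinj : Function.Injective P)
    (hPrange : ∀ R : AlgFun.Place K (RatFunc K),
      R ∈ Set.range P ↔ R.ord (algebraMap (Polynomial K) (RatFunc K) f) ≠ 0)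
    (lam : Fin r → ℤ)
    (hlam : ∀ k, lam k = (P k).ord (algebraMap (Polynomial K) (RatFunc K) f))
    -- the first `n` of them are totally ramified, with `Q_k` above `P_k`
    (n : ℕ) (hn2 : 2 ≤ n) (hnq : n ≤ Nat.card K) (hnr : n ≤ r)
    (Q : Fin n → AlgFun.Place K F)
    (hQ : ∀ k : Fin n, AlgFun.IsTotallyRamified (Q k) (P (Fin.castLE hnr k)))
    (α : Fin n → ℤ) :
    FiniteDimensional K
        (AlgFun.riemannRochSpace (∑ k : Fin n, Finsupp.single (Q k) (α k))) ∧
      (AlgFun.ell (∑ k : Fin n, Finsupp.single (Q k) (α k)) : ℤ) =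
        max 0 (1 + ∑ k : Fin n, ⌊(α k : ℚ) / (m : ℚ)⌋) +
          ∑ i ∈ Finset.Icc 1 (m - 1),
            max 0 ((n : ℤ) - AlgFun.kummerBeta m lam i +
              ∑ k : Fin n,
                ⌊((α k - AlgFun.kummerT m (lam (Fin.castLE hnr k)) i : ℤ) : ℚ) / (m : ℚ)⌋) := by

  have hmK : (m : K) ≠ 0 := fun h => hchar ((ringChar.spec K m).1 h)
  have hmpos : 0 < m := by omega
  have hf0 : f ≠ 0 := by
    rintro rfl
    simp at hdeg
  set f0 := algebraMap (Polynomial K) (RatFunc K) f with hf0def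
  have hf : f0 ≠ 0 := algebraMap_ratFunc_ne_zero hf0
  have hfin : Module.finrank (RatFunc K) F = m :=
    (hQ ⟨0, by omega⟩).finrank_eq_of_kummer hmK hf hy hpow hgen
  have hgcd : ∀ k : Fin n, Int.gcd ((P (Fin.castLE hnr k)).ord f0) m = 1 := fun k =>
    (hQ k).gcd_ord_eq_one hmK hf hy hpow
  have hQ' : ∀ k : Fin n, HasRamificationIndex (Q k) (P (Fin.castLE hnr k)) m := fun k => by
    have := hQ k
    rwa [IsTotallyRamified, hfin] at this
  have hQinj : Function.Injective Q := by
    intro k l hkl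
    have h1 := (hQ' k).place_below_unique (hkl ▸ hQ' l)
    exact Fin.castLE_injective hnr (hPinj h1)
  obtain ⟨B, hB⟩ := (hQ' ⟨0, by omega⟩).exists_kummer_basis hf hy (hgcd _) hfin
  -- At infinity `f` has order `-deg f`, which is nonzero.
  obtain ⟨k0, hk0⟩ : ∃ k0, P k0 = Place.infty K := by
    apply (hPrange _).2
    rw [Place.ord_infty hf, hf0def, RatFunc.intDegree_polynomial]
    omega
  have hroot : ∀ k, ∃ a, k ≠ k0 → P k = Place.root a := by
    intro k
    by_cases hk : k = k0
    · exact ⟨0, fun h => absurd hk h⟩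
    · obtain ⟨a, ha⟩ := Place.exists_eq_root_of_splits hroots (R := P k)
        (fun h => hk (hPinj (h.trans hk0.symm))) ((hPrange _).1 ⟨k, rfl⟩)
      exact ⟨a, fun _ => ha⟩
  choose a ha using hroot
  let α' : Fin r → ℤ := fun k => if h : (k : ℕ) < n then α ⟨k, h⟩ else 0
  have hα : ∀ k, α' (Fin.castLE hnr k) = α k := fun k => by simp [α']
  have hα0 : ∀ k : Fin r, n ≤ k → α' k = 0 := fun k hk => dif_neg (not_lt.2 hk)
  -- Rounding of the condition `m ν(aᵢ) - i λ_k + α'_k ≥ 0` on the coefficient of `y⁻ⁱ`.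
  let c : ℕ → Fin r → ℤ := fun i k => (α' k - i * lam k) / m
  let D' : Fin m → Divisor K (RatFunc K) := fun i => ∑ k, Finsupp.single (P k) (c i k)
  have hRR := fun i : Fin m => finrank_riemannRochSpace_ratFunc P k0 hk0 a ha (c i)
  have hD1 : ∀ (i : Fin m) (k : Fin n), D' i (P (Fin.castLE hnr k)) =
      (α k - (i : ℕ) * (P (Fin.castLE hnr k)).ord f0) / m := by
    intro i k
    simp only [D', c]
    rw [sum_single_apply_of_injective hPinj, hα, hlam]
  have hD2 : ∀ (i : Fin m) (R : Place K (RatFunc K)), (∀ k : Fin n, P (Fin.castLE hnr k) ≠ R) →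
      D' i R = (-((i : ℕ) * R.ord f0)) / m := by
    intro i R hR
    by_cases hk : ∃ k, P k = R
    · obtain ⟨k, rfl⟩ := hk
      have hkn : n ≤ k := by
        by_contra! hlt
        exact hR ⟨k, hlt⟩ rfl
      simp only [D', c]
      rw [sum_single_apply_of_injective hPinj, hα0 k hkn, hlam, zero_sub]
    · have h0 : R.ord f0 = 0 := by
        by_contra h0
        exact hk ((hPrange R).2 h0)
      push Not at hk
      rw [h0, sum_single_apply_of_forall_ne _ hk]
      simp
  obtain ⟨h1, h2⟩ := finrank_riemannRochSpace_of_basis B _ D'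
    (mem_riemannRochSpace_kummer hmK hf hy hgen hfin hQinj hQ' hgcd α B hB D' hD1 hD2)
    (fun i => (hRR i).1)
  refine ⟨h1, ?_⟩
  rw [ell, h2, Nat.cast_sum]
  have h3 : ∀ i : Fin m, ((Module.finrank K (riemannRochSpace (D' i)) : ℕ) : ℤ) =
      max 0 (1 + ∑ k, c i k) := fun i => by
    rw [(hRR i).2, Int.toNat_eq_max, max_comm]
  simp only [h3]
  -- The index `i = 0`, where `λ` drops out, gives the separate first summand of the formula.
  rw [Fin.sum_univ_eq_sum_range (fun i => max 0 (1 + ∑ k, c i k)) m, Finset.range_eq_Ico,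
    Finset.sum_eq_sum_Ico_succ_bot hmpos]
  have hIcc : Finset.Icc 1 (m - 1) = Finset.Ico (0 + 1) m := by
    ext i
    simp only [Finset.mem_Icc, Finset.mem_Ico]
    omega
  rw [hIcc]
  congr 1
  · congr 2
    rw [Fin.sum_eq_sum_castLE hnr]
    · refine Finset.sum_congr rfl fun k _ => ?_
      simp [c, hα, Rat.floor_intCast_div_natCast]
    · intro k hk
      simp [c, hα0 k hk]
  · refine Finset.sum_congr rfl fun i hi => ?_
    rw [Finset.mem_Ico] at hi
    rw [← kummer_floor_identity hmpos hnr lam α' α hα hα0 (fun k => by rw [hlam]; exact hgcd k)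
      (by omega) hi.2]
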